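/- Let $n\ge 1$, $m\ge 0$, and let $f:\mathbb C^n\to\mathbb R$ be a real-valued polynomial of the form $f(z,\bar z)=\sum_{|\alpha|=|\beta|=m}c_{\alpha\beta}z^\alpha\bar z^\beta$, i.e. bihomogeneous of degree $(m,m)$. Write $\|z\|^2=\sum_j|z_j|^2$ and $\langle z,\zeta\rangle=\sum_j z_j\bar\zeta_j$; let $B_n$ be the open unit ball, $dV$ Lebesgue measure, $\langle g,h\rangle_{A^2}=\int_{B_n}g\bar h\,dV$, and let $V_k$ be the space of holomorphic homogeneous polynomials of degree $k$ on $\mathbb C^n$. Let $H_d$ be the map whose components are the monomials $\sqrt{d!/\alpha!}\,z^\alpha$, $|\alpha|=d$ (so $\|H_d(z)\|^2=\|z\|^{2d}$), and for vector-valued maps let $h\otimes g$ be the map with components all products $h_jg_k$. In (2)-(5), $d$ is a non-negative integer. The following are equivalent: (1) $f$ attains a positive minimum on the unit sphere $\|z\|=1$. (2) For some $d$, $\|z\|^{2d}f(z,\bar z)=\sum_{|\mu|=|\nu|=m+d}E_{\mu\nu}z^\mu\bar z^\nu$ with $(E_{\mu\nu})$ a positive definite Hermitian matrix. (3) For some $d$,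 the operator $R_{m+d}\,g(z)=\int_{B_n}\langle z,\zeta\rangle^d f(z,\bar\zeta)\,g(\zeta)\,dV(\zeta)$, where $f(z,\bar\zeta)=\sum c_{\alpha\beta}z^\alpha\bar\zeta^\beta$, maps $V_{m+d}$ to itself and is positive there: there is $\varepsilon>0$ with $\langle R_{m+d}\,g,g\rangle_{A^2}\ge\varepsilon\langle g,g\rangle_{A^2}$ for all $g\in V_{m+d}$. (4) For some $d$ there is a holomorphic homogeneous polynomial map $g:\mathbb C^n\to\mathbb C^k$ of degree $m+d$ (for some $k$) such that $\{z: g(z)=0\}=\{0\}$ and $\|z\|^{2d}f(z,\bar z)=\|g(z)\|^2$. (5) For every pair of holomorphic homogeneous polynomial maps $P,N$ of degree $m$, with values in finite-dimensional spaces $\mathbb C^p,\mathbb C^q$, such that $f=\|P\|^2-\|N\|^2$, there are $d$ and a linear map $L$ such that $I-L^*L$ is positive semi-definite, $H_d\otimes N=L(H_d\otimes P)$, and $\{z:\sqrt{I-L^*L}\,(H_d(z)\otimes P(z))=0\}=\{0\}$. (5') There are at least one such pair $P,N$ with $f=\|P\|^2-\|N\|^2$ and $d$, $L$ with the properties in (5).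 -/

import Mathlib

open scoped ComplexOrder

noncomputable section

namespace HermitianStabilization

/-- Complex Euclidean space `ℂⁿ` with the norm `‖z‖² = ∑ |z_j|²`. -/
abbrev Cn (n : ℕ) : Type := EuclideanSpace ℂ (Fin n)

/-- Multi-indices `α ∈ ℕⁿ` with `|α| = k`. -/
abbrev MultiIndex (n k : ℕ) : Type := {α : Fin n → ℕ // ∑ i, α i = k}

instance instFintypeMultiIndex (n k : ℕ) : Fintype (MultiIndex n k) :=
  Fintype.subtype (Finset.piAntidiag Finset.univ k) (by simp [Finset.mem_piAntidiag])

/-- The monomial `z^α`. -/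
def monom {n k : ℕ} (α : MultiIndex n k) (z : Cn n) : ℂ := ∏ i, z i ^ α.1 i

/-- The bihomogeneous polynomial with coefficient matrix `c`, polarized:
`∑ c_{αβ} z^α (conj ζ)^β`. -/
def bihom {n k : ℕ} (c : Matrix (MultiIndex n k) (MultiIndex n k) ℂ) (z ζ : Cn n) : ℂ :=
  ∑ α, ∑ β, c α β * monom α z * star (monom β ζ)

/-- `c` is the underlying matrix of coefficients of the real-valued function `F`:
`F(z) = ∑_{|α| = |β| = k} c_{αβ} z^α (conj z)^β`. -/
def IsUnderlyingMatrix {n k : ℕ} (F : Cn n → ℝ)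
    (c : Matrix (MultiIndex n k) (MultiIndex n k) ℂ) : Prop :=
  ∀ z, (F z : ℂ) = bihom c z z

/-- The space `V_k` of holomorphic homogeneous polynomials of degree `k` on `ℂⁿ`,
as a space of functions. -/
def V (n k : ℕ) : Submodule ℂ (Cn n → ℂ) where
  carrier := {h | ∃ p : MvPolynomial (Fin n) ℂ, p.IsHomogeneous k ∧
    ∀ z : Cn n, h z = MvPolynomial.eval (fun i => z i) p}
  zero_mem' := ⟨0, MvPolynomial.isHomogeneous_zero _ _ _, fun z => by simp⟩
  add_mem' := by
    rintro a b ⟨p, hp, hpa⟩ ⟨q, hq, hqb⟩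
    exact ⟨p + q, hp.add hq, fun z => by simp [hpa z, hqb z]⟩
  smul_mem' := by
    rintro a h ⟨p, hp, hph⟩
    refine ⟨MvPolynomial.C a * p, ?_, fun z => by simp [hph z]⟩
    simpa using (MvPolynomial.isHomogeneous_C (Fin n) a).mul hp

/-- A holomorphic homogeneous vector-valued polynomial of degree `k`, with values in `ℂ^N`. -/
def IsHomogeneousMap {n N : ℕ} (k : ℕ) (g : Cn n → Cn N) : Prop :=
  ∀ j, (fun z => g z j) ∈ V n k

/-- The `L²` inner product on the unit ball, with respect to Lebesgue measure,
linear in the first slot. -/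
def ballInner {n : ℕ} (g h : Cn n → ℂ) : ℂ :=
  ∫ z in Metric.ball (0 : Cn n) 1, g z * star (h z)

/-- The integral operator over the unit ball with kernel `K(z, ζ)`. -/
def kernelOp {n : ℕ} (K : Cn n → Cn n → ℂ) (g : Cn n → ℂ) (z : Cn n) : ℂ :=
  ∫ ζ in Metric.ball (0 : Cn n) 1, K z ζ * g ζ

/-- The kernel `⟨z, ζ⟩^d f(z, conj ζ)`, where `f` has coefficient matrix `c`. -/
def stabKernel {n m : ℕ} (c : Matrix (MultiIndex n m) (MultiIndex n m) ℂ) (d : ℕ)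
    (z ζ : Cn n) : ℂ :=
  (∑ i, z i * star (ζ i)) ^ d * bihom c z ζ

/-- The operator `R` maps `V_k` to itself and is positive there with respect to the
inner product of the Bergman space `A²` of the ball: for some `ε > 0`,
`⟨Rg, g⟩ ≥ ε ⟨g, g⟩` for all `g ∈ V_k`.  The order is that of `ℂ`, so the inequality
says in particular that `⟨Rg, g⟩` is real. -/
def IsPositiveOn {n : ℕ} (R : (Cn n → ℂ) → Cn n → ℂ) (k : ℕ) : Prop :=
  (∀ g ∈ V n k, R g ∈ V n k) ∧
  ∃ ε : ℝ, 0 < ε ∧ ∀ g ∈ V n k, (ε : ℂ) * ballInner g g ≤ ballInner (R g) g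

/-- The map `H_d`, whose components are the monomials `√(d!/α!) z^α`, `|α| = d`. -/
def H {n : ℕ} (d : ℕ) (z : Cn n) : EuclideanSpace ℂ (MultiIndex n d) :=
  WithLp.toLp 2 fun α =>
    ((Real.sqrt ((d.factorial : ℝ) / ∏ i, ((α.1 i).factorial : ℝ)) : ℝ) : ℂ) * monom α z

/-- The tensor product of two vectors: all products of their components. -/
def tensor {ι κ : Type} [Fintype ι] [Fintype κ] (v : EuclideanSpace ℂ ι)
    (w : EuclideanSpace ℂ κ) : EuclideanSpace ℂ (ι × κ) :=
  WithLp.toLp 2 fun p => v p.1 * w p.2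

/-- `P` and `N` are holomorphic homogeneous vector-valued polynomials of degree `m` with
`f = ‖P‖² - ‖N‖²`. -/
def IsDecomposition {n p q : ℕ} (f : Cn n → ℝ) (m : ℕ) (P : Cn n → Cn p) (N : Cn n → Cn q) :
    Prop :=
  IsHomogeneousMap m P ∧ IsHomogeneousMap m N ∧ ∀ z, f z = ‖P z‖ ^ 2 - ‖N z‖ ^ 2

/-- For some `d` and some linear map `L`, `I - L*L` is positive semi-definite,
`H_d ⊗ N = L (H_d ⊗ P)`, and `√(I - L*L) (H_d ⊗ P)` vanishes exactly at the origin. -/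
def ContractionCondition {n p q : ℕ} (P : Cn n → Cn p) (N : Cn n → Cn q) : Prop :=
  ∃ (d : ℕ) (L : EuclideanSpace ℂ (MultiIndex n d × Fin p) →L[ℂ]
      EuclideanSpace ℂ (MultiIndex n d × Fin q)),
    (1 - (ContinuousLinearMap.adjoint L).comp L).IsPositive ∧
    (∀ z, tensor (H d z) (N z) = L (tensor (H d z) (P z))) ∧
    {z | CFC.sqrt (1 - (ContinuousLinearMap.adjoint L).comp L) (tensor (H d z) (P z)) = 0} = {0}

end HermitianStabilization

end

/-! The core is (1) ⇒ (2): if `f ≥ δ‖z‖^(2m)` with `δ > 0`, then the matrix of `‖z‖^(2d) f` is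
positive definite for all large `d` (`eventually_posDef_stabMatrix`). Put `k = m + d` and compare
two Hermitian forms in the coefficients `y` of a polynomial `h` of degree `k`. The Toeplitz form
`antiForm` is, up to `π^n`, the integral of `f |h|²` against a Gaussian, so it inherits the lower
bound on `f` and is at least `δ k^m ∑ μ! |y_μ|²` (`le_antiForm`). The form of `stabMatrix` at the
vector `μ! y_μ` is `d!` times a sum over the same indices, with the weight `(α+ν)!` replaced by `μ!
ν!/(ν-β)!` (`dotProduct_stabMatrix`). These are the anti-normal and normal orderings of one symbol.
They differ only by `O(k^(m-1)) ∑ μ! |y_μ|²` (`norm_antiForm_sub_le`), which loses against `δ k^m`.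

The other conditions are linear algebra on the positive definite matrix `E` of `‖z‖^(2d) f`. With
`G` the Gram matrix of monomials on the ball, the operator in (3) satisfies `⟨Rg, g⟩ = (Gb)* E (Gb)`
for `g` with coefficients `b`, and `G` is invertible. Factoring `E` gives (4). For (5), write `A`
and `B` for the coefficient matrices of `H_d ⊗ P` and `H_d ⊗ N`; positivity of `E` says `‖Bx‖ <
‖Ax‖` for `x ≠ 0`, so `B` factors through `A` by a contraction. Conversely, (2), (4) and (5') each
force `f > 0` off the origin, (3) returns to (2), and compactness of the sphere gives (1). -/

noncomputable section

namespace HermitianStabilization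

open MeasureTheory

variable {n k m : ℕ}

/-! ### Homogeneous polynomials and their coefficient vectors. -/

/-- The homogeneous polynomial with coefficient vector `b`, as a formal polynomial. -/
def toPoly (b : MultiIndex n k → ℂ) : MvPolynomial (Fin n) ℂ :=
  ∑ ν, MvPolynomial.monomial (Finsupp.equivFunOnFinite.symm ν.1) (b ν)

/-- The homogeneous polynomial with coefficient vector `b`, as a function. -/
def hpoly (b : MultiIndex n k → ℂ) (z : Cn n) : ℂ := ∑ ν, b ν * monom ν z

lemma eval_toPoly (b : MultiIndex n k → ℂ) (z : Fin n → ℂ) :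
    MvPolynomial.eval z (toPoly b) = ∑ ν, b ν * ∏ i, z i ^ ν.1 i := by
  simp only [toPoly, map_sum]
  refine Finset.sum_congr rfl fun ν _ => ?_
  rw [MvPolynomial.eval_monomial, Finsupp.prod_fintype _ _ (by simp)]
  rfl

lemma coeff_toPoly (b : MultiIndex n k → ℂ) (ν : MultiIndex n k) :
    (toPoly b).coeff (Finsupp.equivFunOnFinite.symm ν.1) = b ν := by
  classical
  rw [toPoly, MvPolynomial.coeff_sum, Finset.sum_eq_single ν]
  · simp
  · intro μ _ h
    rw [MvPolynomial.coeff_monomial, if_neg]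
    intro h2
    exact h (Subtype.ext (Finsupp.equivFunOnFinite.symm.injective h2))
  · simp

lemma isHomogeneous_toPoly (b : MultiIndex n k → ℂ) : (toPoly b).IsHomogeneous k := by
  refine MvPolynomial.IsHomogeneous.sum _ _ _ fun ν _ => ?_
  refine MvPolynomial.isHomogeneous_monomial _ ?_
  rw [Finsupp.degree_eq_sum]
  exact ν.2

lemma hpoly_eq_eval (b : MultiIndex n k → ℂ) (z : Cn n) :
    hpoly b z = MvPolynomial.eval (fun i => z i) (toPoly b) := by
  rw [eval_toPoly]; rfl

lemma coeff_eq_zero_of_forall (b : MultiIndex n k → ℂ)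
    (h : ∀ z : Fin n → ℂ, ∑ ν, b ν * ∏ i, z i ^ ν.1 i = 0) : b = 0 := by
  have : toPoly b = 0 := MvPolynomial.funext fun z => by rw [eval_toPoly, h, map_zero]
  ext ν
  rw [← coeff_toPoly b ν, this]; simp

lemma hpoly_eq_zero {b : MultiIndex n k → ℂ} (h : ∀ z, hpoly b z = 0) : b = 0 :=
  coeff_eq_zero_of_forall b fun z => h (WithLp.toLp 2 z)

lemma hpoly_mem (b : MultiIndex n k → ℂ) : hpoly b ∈ V n k :=
  ⟨toPoly b, isHomogeneous_toPoly b, hpoly_eq_eval b⟩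

lemma exists_hpoly {h : Cn n → ℂ} (hh : h ∈ V n k) : ∃ b : MultiIndex n k → ℂ, h = hpoly b := by
  obtain ⟨p, hp, hz⟩ := hh
  refine ⟨fun ν => p.coeff (Finsupp.equivFunOnFinite.symm ν.1), ?_⟩
  have : p = toPoly fun ν : MultiIndex n k => p.coeff (Finsupp.equivFunOnFinite.symm ν.1) := by
    ext d
    by_cases hd : ∑ i, d i = k
    · have := coeff_toPoly (fun ν : MultiIndex n k =>
        p.coeff (Finsupp.equivFunOnFinite.symm ν.1)) ⟨d, hd⟩
      simpa using this.symm
    · have h1 : d.degree ≠ k := by rwa [Finsupp.degree_eq_sum]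
      rw [hp.coeff_eq_zero h1, (isHomogeneous_toPoly _).coeff_eq_zero h1]
  ext z
  rw [hz, hpoly_eq_eval, ← this]

lemma continuous_monom (α : MultiIndex n k) : Continuous (monom α) := by
  unfold monom; fun_prop

lemma continuous_hpoly (b : MultiIndex n k → ℂ) : Continuous (hpoly b) := by
  unfold hpoly
  exact continuous_finsetSum _ fun ν _ => (continuous_monom ν).const_mul _

lemma monom_smul (α : MultiIndex n k) (t : ℂ) (z : Cn n) :
    monom α (t • z) = t ^ k * monom α z := by
  simp only [monom, PiLp.smul_apply, smul_eq_mul, mul_pow, Finset.prod_mul_distrib,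
    Finset.prod_pow_eq_pow_sum, α.2]

lemma hpoly_smul (b : MultiIndex n k → ℂ) (t : ℂ) (z : Cn n) :
    hpoly b (t • z) = t ^ k * hpoly b z := by
  simp only [hpoly, monom_smul, Finset.mul_sum]
  exact Finset.sum_congr rfl fun _ _ => by ring

/-- The sum of two multi-indices. -/
def MultiIndex.add {k l : ℕ} (α : MultiIndex n k) (β : MultiIndex n l) : MultiIndex n (k + l) :=
  ⟨α.1 + β.1, by simp [Finset.sum_add_distrib, α.2, β.2]⟩

lemma monom_add {k l : ℕ} (α : MultiIndex n k) (β : MultiIndex n l) (z : Cn n) :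
    monom (α.add β) z = monom α z * monom β z := by
  simp [monom, MultiIndex.add, pow_add, Finset.prod_mul_distrib]

/-- `k e_i`. -/
def MultiIndex.single (k : ℕ) (i : Fin n) : MultiIndex n k := ⟨Pi.single i k, by simp⟩

lemma monom_single (i : Fin n) (z : Cn n) : monom (MultiIndex.single k i) z = z i ^ k := by
  rw [monom, Finset.prod_eq_single i]
  · simp [MultiIndex.single]
  · intro j _ h
    simp [MultiIndex.single, Pi.single_eq_of_ne h]
  · simp

lemma exists_monom_ne_zero {z : Cn n} (hz : z ≠ 0) : ∃ α : MultiIndex n k, monom α z ≠ 0 := by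
  obtain ⟨i, hi⟩ : ∃ i, z i ≠ 0 := by
    by_contra! h
    exact hz (by ext i; exact h i)
  exact ⟨MultiIndex.single k i, by rw [monom_single]; exact pow_ne_zero _ hi⟩

lemma monom_zero (hk : k ≠ 0) (α : MultiIndex n k) : monom α 0 = 0 := by
  have := monom_smul α 0 0
  rwa [zero_smul, zero_pow hk, zero_mul] at this

/-! ### Polarization and uniqueness of the coefficient matrix. -/

/-- A polynomial in `z, w` vanishing for `w = conj z` vanishes identically. -/
lemma bipoly_eq_zero {c : Matrix (MultiIndex n k) (MultiIndex n k) ℂ}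
    (h : ∀ z, bihom c z z = 0) (z w : Fin n → ℂ) :
    ∑ α, ∑ β, c α β * (∏ i, z i ^ α.1 i) * (∏ i, w i ^ β.1 i) = 0 := by
  -- `Q` is the polynomial in the coordinates `z = x + iy`, `w = x - iy`. At real `x, y` one has `w
  -- = conj z`, so `Q` vanishes on all real points and hence identically; `x` and `y` are then
  -- solved for arbitrary `z, w`.
  let Q : MvPolynomial (Fin n ⊕ Fin n) ℂ := ∑ α, ∑ β, MvPolynomial.C (c α β) *
    (∏ i, (MvPolynomial.X (Sum.inl i) + MvPolynomial.C Complex.I *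
      MvPolynomial.X (Sum.inr i)) ^ α.1 i) *
    (∏ i, (MvPolynomial.X (Sum.inl i) - MvPolynomial.C Complex.I *
      MvPolynomial.X (Sum.inr i)) ^ β.1 i)
  have hev : ∀ x, MvPolynomial.eval x Q = ∑ α, ∑ β, c α β *
      (∏ i, (x (Sum.inl i) + Complex.I * x (Sum.inr i)) ^ α.1 i) *
      (∏ i, (x (Sum.inl i) - Complex.I * x (Sum.inr i)) ^ β.1 i) := by
    intro x
    simp [Q, map_sum, map_prod]
  have hQ : Q = 0 := by
    refine MvPolynomial.funext_set (fun _ => Set.range ((↑) : ℝ → ℂ))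
      (fun _ => Set.infinite_range_of_injective Complex.ofReal_injective) fun x hx => ?_
    rw [hev, map_zero]
    have h1 := h (WithLp.toLp 2 fun i => x (Sum.inl i) + Complex.I * x (Sum.inr i))
    rw [← h1]
    have hreal : ∀ j, star (x j) = x j := by
      intro j
      obtain ⟨r, hr⟩ := hx j (Set.mem_univ _)
      rw [← hr]; exact Complex.conj_ofReal r
    simp only [bihom, monom, star_prod, star_pow, star_add, star_mul', hreal]
    simp [sub_eq_add_neg]
  have h2 := hev (Sum.elim (fun i => (z i + w i) / 2) (fun i => (z i - w i) / (2 * Complex.I)))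
  rw [hQ, map_zero] at h2
  rw [h2]
  have e1 : ∀ i, (z i + w i) / 2 + Complex.I * ((z i - w i) / (2 * Complex.I)) = z i := by
    intro i
    have := Complex.I_ne_zero
    field_simp; ring
  have e2 : ∀ i, (z i + w i) / 2 - Complex.I * ((z i - w i) / (2 * Complex.I)) = w i := by
    intro i
    have := Complex.I_ne_zero
    field_simp; ring
  simp only [Sum.elim_inl, Sum.elim_inr, e1, e2]

lemma matrix_eq_zero_of_bihom {c : Matrix (MultiIndex n k) (MultiIndex n k) ℂ}
    (h : ∀ z, bihom c z z = 0) : c = 0 := by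
  have h1 : ∀ z : Fin n → ℂ, (fun β => ∑ α, c α β * ∏ i, z i ^ α.1 i) = 0 := by
    intro z
    refine coeff_eq_zero_of_forall _ fun w => ?_
    rw [← bipoly_eq_zero h z w, Finset.sum_comm]
    simp only [Finset.sum_mul]
  ext α β
  exact congrFun (coeff_eq_zero_of_forall (fun α => c α β) fun z => congrFun (h1 z) β) α

lemma bihom_sub (c c' : Matrix (MultiIndex n k) (MultiIndex n k) ℂ) (z ζ : Cn n) :
    bihom (c - c') z ζ = bihom c z ζ - bihom c' z ζ := by
  simp [bihom, sub_mul, Finset.sum_sub_distrib]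

/-- The underlying matrix of coefficients is unique. -/
lemma IsUnderlyingMatrix.unique {F : Cn n → ℝ} {c c' : Matrix (MultiIndex n k) (MultiIndex n k) ℂ}
    (h : IsUnderlyingMatrix F c) (h' : IsUnderlyingMatrix F c') : c = c' := by
  rw [← sub_eq_zero]
  refine matrix_eq_zero_of_bihom fun z => ?_
  rw [bihom_sub, ← h z, ← h' z, sub_self]

lemma star_bihom (c : Matrix (MultiIndex n k) (MultiIndex n k) ℂ) (z ζ : Cn n) :
    star (bihom c z ζ) = bihom c.conjTranspose ζ z := by
  simp only [bihom, star_sum]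
  rw [Finset.sum_comm]
  refine Finset.sum_congr rfl fun _ _ => Finset.sum_congr rfl fun _ _ => ?_
  simp only [star_mul', star_star, Matrix.conjTranspose_apply]
  ring

/-- The underlying matrix of a real-valued function is Hermitian. -/
lemma IsUnderlyingMatrix.isHermitian {F : Cn n → ℝ}
    {c : Matrix (MultiIndex n k) (MultiIndex n k) ℂ} (h : IsUnderlyingMatrix F c) :
    c.IsHermitian :=
  IsUnderlyingMatrix.unique (F := F) (fun z => by rw [← star_bihom, ← h z]; simp) h

lemma bihom_eq_dotProduct (c : Matrix (MultiIndex n k) (MultiIndex n k) ℂ) (z : Cn n) :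
    bihom c z z = star (fun α => star (monom α z)) ⬝ᵥ c.mulVec (fun α => star (monom α z)) := by
  simp only [bihom, dotProduct, Matrix.mulVec, Finset.mul_sum, Pi.star_apply, star_star]
  exact Finset.sum_congr rfl fun _ _ => Finset.sum_congr rfl fun _ _ => by ring

/-! ### The coefficient matrix of `⟨z, ζ⟩^d f(z, conj ζ)`. -/

/-- The multinomial coefficient `d! / γ!`, as a real number. -/
def multinom {d : ℕ} (γ : MultiIndex n d) : ℝ := (d.factorial : ℝ) / ∏ i, ((γ.1 i).factorial : ℝ)

/-- The matrix of the polynomial `⟨z, ζ⟩^d f(z, conj ζ)`. -/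
def stabMatrix (c : Matrix (MultiIndex n m) (MultiIndex n m) ℂ) (d : ℕ) :
    Matrix (MultiIndex n (m + d)) (MultiIndex n (m + d)) ℂ := fun μ ν =>
  ∑ t : MultiIndex n m × MultiIndex n m × MultiIndex n d,
    if t.1.add t.2.2 = μ ∧ t.2.1.add t.2.2 = ν then c t.1 t.2.1 * (multinom t.2.2 : ℂ) else 0

lemma univ_prod_factorial_pos (γ : Fin n → ℕ) : 0 < ∏ i, ((γ i).factorial : ℝ) :=
  Finset.prod_pos fun _ _ => by positivity

lemma multinom_pos {d : ℕ} (γ : MultiIndex n d) : 0 < multinom γ :=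
  div_pos (by positivity) (univ_prod_factorial_pos _)

lemma multinom_eq {d : ℕ} (γ : MultiIndex n d) :
    multinom γ = (Nat.multinomial Finset.univ γ.1 : ℝ) := by
  rw [multinom, div_eq_iff (univ_prod_factorial_pos _).ne']
  have := Nat.multinomial_spec Finset.univ γ.1
  rw [γ.2, mul_comm] at this
  exact_mod_cast this.symm

lemma sum_pow_eq_sum_multiIndex {R : Type*} [CommSemiring R] (d : ℕ) (x : Fin n → R) :
    (∑ i, x i) ^ d = ∑ γ : MultiIndex n d,
      (Nat.multinomial Finset.univ γ.1 : R) * ∏ i, x i ^ γ.1 i := by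
  rw [Finset.sum_pow_eq_sum_piAntidiag]
  symm
  exact Finset.sum_bij (fun γ _ => γ.1) (fun γ _ => by simp [γ.2])
    (fun _ _ _ _ h => Subtype.ext h)
    (fun b hb => ⟨⟨b, by simpa using hb⟩, Finset.mem_univ _, rfl⟩) fun γ _ => rfl

lemma sum_mul_star_pow (d : ℕ) (z ζ : Cn n) :
    (∑ i, z i * star (ζ i)) ^ d = ∑ γ : MultiIndex n d,
      (multinom γ : ℂ) * (monom γ z * star (monom γ ζ)) := by
  rw [sum_pow_eq_sum_multiIndex]
  refine Finset.sum_congr rfl fun γ _ => ?_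
  rw [multinom_eq]
  simp [monom, mul_pow, Finset.prod_mul_distrib]

lemma sum_sum_ite_mul {T A B : Type*} [Fintype T] [Fintype A] [Fintype B] [DecidableEq A]
    [DecidableEq B] (a : T → A) (b : T → B) (w : T → ℂ) (F : A → ℂ) (G : B → ℂ) :
    ∑ μ, ∑ ν, (∑ t, if a t = μ ∧ b t = ν then w t else 0) * F μ * G ν =
      ∑ t, w t * F (a t) * G (b t) := by
  simp only [Finset.sum_mul]
  rw [Finset.sum_congr rfl fun _ _ => Finset.sum_comm, Finset.sum_comm]
  refine Finset.sum_congr rfl fun t _ => ?_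
  rw [Finset.sum_eq_single (a t), Finset.sum_eq_single (b t)]
  · simp
  · intro ν _ h; simp [h.symm]
  · simp
  · intro μ _ h
    exact Finset.sum_eq_zero fun ν _ => by simp [h.symm]
  · simp

lemma stabKernel_eq_bihom (c : Matrix (MultiIndex n m) (MultiIndex n m) ℂ) (d : ℕ) (z ζ : Cn n) :
    stabKernel c d z ζ = bihom (stabMatrix c d) z ζ := by
  simp only [bihom, stabMatrix]
  rw [sum_sum_ite_mul (fun t : MultiIndex n m × MultiIndex n m × MultiIndex n d => t.1.add t.2.2)
    (fun t => t.2.1.add t.2.2) (fun t => c t.1 t.2.1 * (multinom t.2.2 : ℂ)) (fun μ => monom μ z)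
    (fun ν => star (monom ν ζ))]
  rw [stabKernel, sum_mul_star_pow, bihom, mul_comm]
  simp only [Fintype.sum_prod_type, Finset.sum_mul]
  refine Finset.sum_congr rfl fun α _ => Finset.sum_congr rfl fun β _ => ?_
  rw [Finset.mul_sum]
  refine Finset.sum_congr rfl fun γ _ => ?_
  rw [monom_add, monom_add, star_mul']
  ring

lemma norm_sq_eq_sum_mul_star (z : Cn n) : ((‖z‖ ^ 2 : ℝ) : ℂ) = ∑ i, z i * star (z i) := by
  rw [EuclideanSpace.norm_sq_eq]
  push_cast
  refine Finset.sum_congr rfl fun i _ => ?_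
  exact (Complex.mul_conj' _).symm

lemma isUnderlyingMatrix_stabMatrix {f : Cn n → ℝ} {c : Matrix (MultiIndex n m) (MultiIndex n m) ℂ}
    (hf : IsUnderlyingMatrix f c) (d : ℕ) :
    IsUnderlyingMatrix (fun z => ‖z‖ ^ (2 * d) * f z) (stabMatrix c d) := fun z => by
  rw [← stabKernel_eq_bihom, stabKernel, ← norm_sq_eq_sum_mul_star, ← hf z]
  push_cast
  ring

/-! ### Gaussian moments of monomials. -/

lemma integral_norm_pow_mul_gaussian (a : ℕ) :
    ∫ z : ℂ, ‖z‖ ^ a * Real.exp (-‖z‖ ^ 2) = Real.pi * Real.Gamma ((a + 2) / 2) := by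
  have := Complex.integral_rpow_mul_exp_neg_rpow (p := 2) (q := a) one_le_two
    (by have : (0 : ℝ) ≤ a := a.cast_nonneg
        linarith)
  rw [mul_div_cancel_left₀ _ (two_ne_zero)] at this
  rw [← this]
  refine integral_congr_ae (Filter.Eventually.of_forall fun z => ?_)
  simp [Real.rpow_natCast]

/-- The Gaussian-weighted monomial `z^a (conj z)^b exp(-|z|^2)`. -/
def gaussMonom (a b : ℕ) (z : ℂ) : ℂ := z ^ a * star z ^ b * (Real.exp (-‖z‖ ^ 2) : ℝ)

lemma integrable_gaussMonom (a b : ℕ) : Integrable (gaussMonom a b) := by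
  have h : Integrable fun z : ℂ => ‖z‖ ^ (a + b) * Real.exp (-‖z‖ ^ 2) := by
    -- A non-integrable function has integral `0` by convention, whereas the formula gives a
    -- positive value.
    by_contra h
    have h1 := integral_norm_pow_mul_gaussian (a + b)
    rw [integral_undef h] at h1
    have : 0 < Real.pi * Real.Gamma (((a + b : ℕ) + 2) / 2) :=
      mul_pos Real.pi_pos (Real.Gamma_pos_of_pos (by positivity))
    exact this.ne h1
  refine h.mono' ?_ (Filter.Eventually.of_forall fun z => ?_)
  · unfold gaussMonom
    exact (by fun_prop : Continuous _).aestronglyMeasurable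
  · simp only [gaussMonom, norm_mul, norm_pow, norm_star, Complex.norm_real, Real.norm_eq_abs,
      Real.abs_exp, pow_add]
    exact le_rfl

lemma integral_gaussMonom_of_ne {a b : ℕ} (hab : a ≠ b) : ∫ z, gaussMonom a b z = 0 := by
  -- Rotation by `θ` multiplies the integrand by `exp(i(a - b)θ) = -1` and preserves the measure, so
  -- the integral equals its own negative.
  set θ : ℝ := Real.pi / ((a : ℝ) - b) with hθ
  have hab' : (a : ℝ) - b ≠ 0 := sub_ne_zero.2 (by exact_mod_cast hab)
  set u : Circle := Circle.exp θ
  have hu : (u : ℂ) ^ a * star (u : ℂ) ^ b = -1 := by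
    have e : star (u : ℂ) = Complex.exp (-(θ * Complex.I)) := by
      simp only [u, Circle.coe_exp]
      rw [← starRingEnd_apply, ← Complex.exp_conj]
      simp
    rw [e, Circle.coe_exp, ← Complex.exp_nat_mul, ← Complex.exp_nat_mul, ← Complex.exp_add,
      ← Complex.exp_pi_mul_I]
    congr 1
    have : (((a : ℝ) - b) * θ : ℝ) = Real.pi := by rw [hθ]; field_simp
    rw [← this]; push_cast; ring
  have h1 := (rotation u).measurePreserving.integral_comp
    (rotation u).toHomeomorph.measurableEmbedding (gaussMonom a b)
  have h2 : ∀ z, gaussMonom a b (rotation u z) = - gaussMonom a b z := by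
    intro z
    simp only [gaussMonom, rotation_apply, star_mul', mul_pow, norm_mul, Circle.norm_coe, one_mul]
    linear_combination (z ^ a * star z ^ b * (Real.exp (-‖z‖ ^ 2) : ℝ)) * hu
  simp only [h2, integral_neg] at h1
  exact self_eq_neg.1 h1.symm

lemma integral_gaussMonom (a b : ℕ) :
    ∫ z, gaussMonom a b z = if a = b then (Real.pi * a.factorial : ℝ) else 0 := by
  split_ifs with h
  · subst h
    have h1 := integral_norm_pow_mul_gaussian (2 * a)
    have h2 : (((2 * a : ℕ) : ℝ) + 2) / 2 = a + 1 := by push_cast; ring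
    rw [h2, Real.Gamma_nat_eq_factorial] at h1
    rw [← h1, ← integral_complex_ofReal]
    refine integral_congr_ae (Filter.Eventually.of_forall fun z => ?_)
    simp only [gaussMonom]
    push_cast
    rw [← mul_pow, pow_mul]
    congr 2
    exact Complex.mul_conj' z
  · exact integral_gaussMonom_of_ne h

/-- The Gaussian density on `ℂⁿ`. -/
def gauss (z : Fin n → ℂ) : ℝ := ∏ i, Real.exp (-‖z i‖ ^ 2)

lemma prod_gaussMonom (a b : Fin n → ℕ) (z : Fin n → ℂ) :
    (∏ i, z i ^ a i) * star (∏ i, z i ^ b i) * (gauss z : ℂ) =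
      ∏ i, gaussMonom (a i) (b i) (z i) := by
  simp [gaussMonom, gauss, Finset.prod_mul_distrib]

lemma integrable_prod_gaussMonom (a b : Fin n → ℕ) :
    Integrable fun z : Fin n → ℂ => (∏ i, z i ^ a i) * star (∏ i, z i ^ b i) * (gauss z : ℂ) := by
  simp only [prod_gaussMonom]
  exact Integrable.fintype_prod fun i => integrable_gaussMonom (a i) (b i)

lemma integral_prod_gaussMonom (a b : Fin n → ℕ) :
    ∫ z : Fin n → ℂ, (∏ i, z i ^ a i) * star (∏ i, z i ^ b i) * (gauss z : ℂ) =
      if a = b then (Real.pi ^ n * ∏ i, ((a i).factorial : ℝ) : ℝ) else 0 := by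
  simp only [prod_gaussMonom]
  rw [integral_fintype_prod_volume_eq_prod]
  simp only [integral_gaussMonom]
  split_ifs with h
  · subst h
    simp [Finset.prod_mul_distrib]
  · obtain ⟨i, hi⟩ := Function.ne_iff.1 h
    exact Finset.prod_eq_zero (Finset.mem_univ i) (by rw [if_neg hi]; simp)

/-! ### The Toeplitz form and its lower bound. -/

/-- The anti-normally ordered (Toeplitz) form with symbol `c`. -/
def antiForm (c : Matrix (MultiIndex n m) (MultiIndex n m) ℂ) (y : MultiIndex n k → ℂ) : ℂ :=
  ∑ α, ∑ β, ∑ μ, ∑ ν, if α.1 + ν.1 = β.1 + μ.1 then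
    c α β * (star (y μ) * y ν) * (∏ i, ((α.1 i + ν.1 i).factorial : ℝ) : ℝ) else 0

/-- Monomials are orthogonal for the Gaussian with squared norm `π^n γ!`. This leaves only the terms
with `α + ν = β + μ` and produces the weight `(α+ν)!` in `antiForm`. -/
lemma integral_bihom_gauss (c : Matrix (MultiIndex n m) (MultiIndex n m) ℂ)
    (y : MultiIndex n k → ℂ) :
    ∫ z : Fin n → ℂ, bihom c (WithLp.toLp 2 z) (WithLp.toLp 2 z) *
      (hpoly y (WithLp.toLp 2 z) * star (hpoly y (WithLp.toLp 2 z))) * (gauss z : ℂ) =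
    Real.pi ^ n * antiForm c y := by
  have h : ∀ z : Fin n → ℂ, bihom c (WithLp.toLp 2 z) (WithLp.toLp 2 z) *
      (hpoly y (WithLp.toLp 2 z) * star (hpoly y (WithLp.toLp 2 z))) * (gauss z : ℂ) =
      ∑ α, ∑ β, ∑ μ, ∑ ν, (c α β * (star (y μ) * y ν)) *
        ((∏ i, z i ^ (α.1 i + ν.1 i)) * star (∏ i, z i ^ (β.1 i + μ.1 i)) * (gauss z : ℂ)) := by
    intro z
    have e : hpoly y (WithLp.toLp 2 z) * star (hpoly y (WithLp.toLp 2 z)) = ∑ μ, ∑ ν,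
        (star (y μ) * y ν) * (monom ν (WithLp.toLp 2 z) * star (monom μ (WithLp.toLp 2 z))) := by
      rw [mul_comm, hpoly, star_sum, Finset.sum_mul_sum]
      refine Finset.sum_congr rfl fun μ _ => Finset.sum_congr rfl fun ν _ => ?_
      rw [star_mul']; ring
    rw [e, bihom]
    simp only [Finset.sum_mul]
    refine Finset.sum_congr rfl fun α _ => Finset.sum_congr rfl fun β _ => ?_
    simp only [Finset.mul_sum, Finset.sum_mul]
    refine Finset.sum_congr rfl fun μ _ => Finset.sum_congr rfl fun ν _ => ?_
    simp only [monom, pow_add, Finset.prod_mul_distrib, star_mul']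
    ring
  simp only [h]
  have hi : ∀ α β μ ν, Integrable fun z : Fin n → ℂ => (c α β * (star (y μ) * y ν)) *
        ((∏ i, z i ^ (α.1 i + ν.1 i)) * star (∏ i, z i ^ (β.1 i + μ.1 i)) * (gauss z : ℂ)) :=
    fun α β μ ν => (integrable_prod_gaussMonom (fun i => α.1 i + ν.1 i)
      (fun i => β.1 i + μ.1 i)).const_mul _
  rw [integral_finsetSum _ fun α _ => integrable_finsetSum _ fun β _ => integrable_finsetSum _
    fun μ _ => integrable_finsetSum _ fun ν _ => hi α β μ ν, antiForm, Finset.mul_sum]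
  refine Finset.sum_congr rfl fun α _ => ?_
  rw [integral_finsetSum _ fun β _ => integrable_finsetSum _
    fun μ _ => integrable_finsetSum _ fun ν _ => hi α β μ ν, Finset.mul_sum]
  refine Finset.sum_congr rfl fun β _ => ?_
  rw [integral_finsetSum _
    fun μ _ => integrable_finsetSum _ fun ν _ => hi α β μ ν, Finset.mul_sum]
  refine Finset.sum_congr rfl fun μ _ => ?_
  rw [integral_finsetSum _ fun ν _ => hi α β μ ν, Finset.mul_sum]
  refine Finset.sum_congr rfl fun ν _ => ?_
  rw [integral_const_mul, integral_prod_gaussMonom (fun i => α.1 i + ν.1 i)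
      (fun i => β.1 i + μ.1 i)]
  have : ((fun i => α.1 i + ν.1 i) = fun i => β.1 i + μ.1 i) ↔ α.1 + ν.1 = β.1 + μ.1 := Iff.rfl
  simp only [this]
  split_ifs
  · push_cast; ring
  · simp

/-- The Toeplitz form of a nonnegative symbol is nonnegative. -/
lemma antiForm_nonneg {F : Cn n → ℝ} {c : Matrix (MultiIndex n m) (MultiIndex n m) ℂ}
    (hF : IsUnderlyingMatrix F c) (h0 : ∀ z, 0 ≤ F z) (y : MultiIndex n k → ℂ) :
    0 ≤ (antiForm c y).re := by
  have h := integral_bihom_gauss c y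
  have h1 : ∀ z : Fin n → ℂ, bihom c (WithLp.toLp 2 z) (WithLp.toLp 2 z) *
      (hpoly y (WithLp.toLp 2 z) * star (hpoly y (WithLp.toLp 2 z))) * (gauss z : ℂ) =
      ((F (WithLp.toLp 2 z) * ‖hpoly y (WithLp.toLp 2 z)‖ ^ 2 * gauss z : ℝ) : ℂ) := by
    intro z
    have e : hpoly y (WithLp.toLp 2 z) * star (hpoly y (WithLp.toLp 2 z)) = _ :=
      Complex.mul_conj' (hpoly y (WithLp.toLp 2 z))
    rw [← hF, e]
    push_cast; rfl
  simp only [h1] at h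
  rw [integral_complex_ofReal] at h
  have h2 := congrArg Complex.re h
  rw [Complex.ofReal_re, ← Complex.ofReal_pow, Complex.re_ofReal_mul] at h2
  have h3 : 0 ≤ Real.pi ^ n * (antiForm c y).re := by
    rw [← h2]
    exact integral_nonneg fun z => mul_nonneg (mul_nonneg (h0 _) (sq_nonneg _))
      (Finset.prod_nonneg fun _ _ => (Real.exp_pos _).le)
  exact nonneg_of_mul_nonneg_right h3 (by positivity)

/-- The coefficient matrix of `‖z‖^{2m}`. -/
def normMatrix (n m : ℕ) : Matrix (MultiIndex n m) (MultiIndex n m) ℂ :=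
  Matrix.diagonal fun α => (multinom α : ℂ)

lemma isUnderlyingMatrix_normMatrix :
    IsUnderlyingMatrix (fun z : Cn n => ‖z‖ ^ (2 * m)) (normMatrix n m) := fun z => by
  beta_reduce
  rw [pow_mul]
  push_cast
  have := norm_sq_eq_sum_mul_star z
  push_cast at this
  rw [this, sum_mul_star_pow, bihom]
  refine Finset.sum_congr rfl fun α _ => ?_
  rw [Finset.sum_eq_single α]
  · simp [normMatrix, mul_assoc]
  · intro β _ h
    simp [normMatrix, Matrix.diagonal_apply_ne' _ h]
  · simp

lemma antiForm_sub_smul (c c' : Matrix (MultiIndex n m) (MultiIndex n m) ℂ) (t : ℂ)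
    (y : MultiIndex n k → ℂ) : antiForm (c - t • c') y = antiForm c y - t * antiForm c' y := by
  simp only [antiForm, Finset.mul_sum, ← Finset.sum_sub_distrib]
  refine Finset.sum_congr rfl fun α _ => Finset.sum_congr rfl fun β _ => ?_
  refine Finset.sum_congr rfl fun μ _ => Finset.sum_congr rfl fun ν _ => ?_
  split_ifs
  · simp; ring
  · simp

/-- The symbol is diagonal, so only `μ = ν` survives. Then `(α+μ)! ≥ μ^α μ!`, and the multinomial
theorem gives `∑ (m!/α!) μ^α = |μ|^m = k^m`. -/
lemma le_antiForm_normMatrix (y : MultiIndex n k → ℂ) :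
    (k : ℝ) ^ m * ∑ μ, (∏ i, ((μ.1 i).factorial : ℝ)) * ‖y μ‖ ^ 2 ≤
      (antiForm (normMatrix n m) y).re := by
  have h : antiForm (normMatrix n m) y = ∑ α : MultiIndex n m, ∑ μ,
      ((multinom α * (∏ i, ((α.1 i + μ.1 i).factorial : ℝ)) * ‖y μ‖ ^ 2 : ℝ) : ℂ) := by
    refine Finset.sum_congr rfl fun α _ => ?_
    rw [Finset.sum_eq_single α]
    · refine Finset.sum_congr rfl fun μ _ => ?_
      rw [Finset.sum_eq_single μ]
      · rw [if_pos rfl]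
        have := Complex.conj_mul' (y μ)
        rw [starRingEnd_apply] at this
        rw [this]
        simp [normMatrix]; ring
      · intro ν _ hν
        rw [if_neg]
        intro h
        exact hν (Subtype.ext (add_left_cancel h))
      · simp
    · intro β _ h
      simp [normMatrix, Matrix.diagonal_apply_ne' _ h]
    · simp
  rw [h, Finset.sum_comm]
  simp only [← Complex.ofReal_sum]
  rw [Complex.ofReal_re, Finset.mul_sum]
  refine Finset.sum_le_sum fun μ _ => ?_
  rw [← Finset.sum_mul, ← mul_assoc]
  refine mul_le_mul_of_nonneg_right ?_ (sq_nonneg _)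
  have hk : (k : ℝ) = ∑ i, (μ.1 i : ℝ) := by exact_mod_cast μ.2.symm
  rw [hk, sum_pow_eq_sum_multiIndex, Finset.sum_mul]
  refine Finset.sum_le_sum fun α _ => ?_
  rw [multinom_eq, mul_assoc, ← Finset.prod_mul_distrib]
  refine mul_le_mul_of_nonneg_left ?_ (Nat.cast_nonneg _)
  refine Finset.prod_le_prod (fun i _ => by positivity) fun i _ => ?_
  have : μ.1 i ^ α.1 i * (μ.1 i).factorial ≤ (α.1 i + μ.1 i).factorial := by
    rw [add_comm (α.1 i), mul_comm]
    exact (Nat.mul_le_mul_left _ (Nat.pow_le_pow_left (Nat.le_succ _) _)).trans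
      Nat.factorial_mul_pow_le_factorial
  exact_mod_cast this

/-- Lower bound for the Toeplitz form of a symbol bounded below by `δ ‖z‖^{2m}`. -/
lemma le_antiForm {f : Cn n → ℝ} {c : Matrix (MultiIndex n m) (MultiIndex n m) ℂ}
    (hf : IsUnderlyingMatrix f c) {δ : ℝ} (hδ : 0 ≤ δ) (h : ∀ z, δ * ‖z‖ ^ (2 * m) ≤ f z)
    (y : MultiIndex n k → ℂ) :
    δ * ((k : ℝ) ^ m * ∑ μ, (∏ i, ((μ.1 i).factorial : ℝ)) * ‖y μ‖ ^ 2) ≤ (antiForm c y).re := by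
  have h1 : IsUnderlyingMatrix (fun z => f z - δ * ‖z‖ ^ (2 * m))
      (c - (δ : ℂ) • normMatrix n m) := fun z => by
    have h2 := isUnderlyingMatrix_normMatrix (m := m) z
    push_cast at h2 ⊢
    rw [bihom_sub, ← hf z, h2]
    simp [bihom, Finset.mul_sum, mul_assoc]
  have h3 := antiForm_nonneg h1 (fun z => sub_nonneg.2 (h z)) y
  rw [antiForm_sub_smul, Complex.sub_re, Complex.re_ofReal_mul, sub_nonneg] at h3
  exact (mul_le_mul_of_nonneg_left (le_antiForm_normMatrix y) hδ).trans h3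

/-! ### Estimates for factorial weights. -/

/-- The factors are exchanged one at a time. Each exchange costs one power of `M`; carrying that `M`
on the left avoids exponents `e - 1`. -/
lemma prod_sub_prod_le {ι : Type*} (s : Finset ι) (u v : ι → ℝ) (e : ι → ℕ) {M t : ℝ} (hM : 0 ≤ M)
    (ht : 0 ≤ t) (h0 : ∀ i ∈ s, 0 ≤ u i) (huv : ∀ i ∈ s, u i ≤ v i) (hv : ∀ i ∈ s, v i ≤ M ^ e i)
    (h : ∀ i ∈ s, M * (v i - u i) ≤ e i * t * M ^ e i) :
    M * (∏ i ∈ s, v i - ∏ i ∈ s, u i) ≤ (∑ i ∈ s, e i : ℕ) * t * M ^ (∑ i ∈ s, e i) := by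
  classical
  induction s using Finset.induction_on with
  | empty => simp
  | insert a s ha ih =>
    rw [Finset.prod_insert ha, Finset.prod_insert ha, Finset.sum_insert ha]
    have ih' := ih (fun i hi => h0 i (Finset.mem_insert_of_mem hi))
      (fun i hi => huv i (Finset.mem_insert_of_mem hi))
      (fun i hi => hv i (Finset.mem_insert_of_mem hi))
      (fun i hi => h i (Finset.mem_insert_of_mem hi))
    have ha0 := h0 a (Finset.mem_insert_self _ _)
    have ha1 := huv a (Finset.mem_insert_self _ _)
    have ha2 := hv a (Finset.mem_insert_self _ _)
    have ha3 := h a (Finset.mem_insert_self _ _)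
    have hV : ∏ i ∈ s, v i ≤ M ^ (∑ i ∈ s, e i) := by
      rw [← Finset.prod_pow_eq_pow_sum]
      exact Finset.prod_le_prod (fun i hi => (h0 i (Finset.mem_insert_of_mem hi)).trans
        (huv i (Finset.mem_insert_of_mem hi))) fun i hi => hv i (Finset.mem_insert_of_mem hi)
    have hV0 : 0 ≤ ∏ i ∈ s, v i := Finset.prod_nonneg fun i hi =>
      (h0 i (Finset.mem_insert_of_mem hi)).trans (huv i (Finset.mem_insert_of_mem hi))
    have e1 : M * (v a * ∏ i ∈ s, v i - u a * ∏ i ∈ s, u i) =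
        (M * (v a - u a)) * ∏ i ∈ s, v i + u a * (M * (∏ i ∈ s, v i - ∏ i ∈ s, u i)) := by ring
    have e2 : ((e a + ∑ i ∈ s, e i : ℕ) : ℝ) * t * M ^ (e a + ∑ i ∈ s, e i) =
        (e a * t * M ^ e a) * M ^ (∑ i ∈ s, e i) +
          M ^ e a * ((∑ i ∈ s, e i : ℕ) * t * M ^ (∑ i ∈ s, e i)) := by
      push_cast; ring
    rw [e1, e2]
    refine add_le_add (mul_le_mul ha3 hV hV0 (by positivity)) ?_
    exact (mul_le_mul_of_nonneg_left ih' ha0).trans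
      (mul_le_mul_of_nonneg_right (ha1.trans ha2) (by positivity))

lemma descFactorial_sub_le {a b s M : ℕ} (j : ℕ) (hab : a ≤ b) (hbs : b ≤ a + s) (hbM : b ≤ M) :
    (M : ℝ) * (b.descFactorial j - a.descFactorial j) ≤ j * s * (M : ℝ) ^ j := by
  rw [Nat.descFactorial_eq_prod_range, Nat.descFactorial_eq_prod_range]
  push_cast
  have := prod_sub_prod_le (Finset.range j) (fun i => ((a - i : ℕ) : ℝ))
    (fun i => ((b - i : ℕ) : ℝ)) (fun _ => 1) (M := M) (t := s) (Nat.cast_nonneg _)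
    (Nat.cast_nonneg _) (fun i _ => Nat.cast_nonneg _)
    (fun i _ => by exact_mod_cast Nat.sub_le_sub_right hab i)
    (fun i _ => by rw [pow_one]; exact_mod_cast (Nat.sub_le _ _).trans hbM)
    (fun i _ => by
      have h1 : ((b - i : ℕ) : ℝ) ≤ (a - i : ℕ) + s := by
        exact_mod_cast (by omega : b - i ≤ a - i + s)
      have h2 : (0 : ℝ) ≤ M := Nat.cast_nonneg _
      simp only [Nat.cast_one, one_mul, pow_one]
      nlinarith)
  simpa using this

/-- The falling factorial `∏ μ_i (μ_i - 1) ⋯ (μ_i - α_i + 1)`, as a real number. -/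
def descFac (μ α : Fin n → ℕ) : ℝ := ∏ i, ((μ i).descFactorial (α i) : ℝ)

lemma le_sum_apply {ι : Type*} [Fintype ι] (a : ι → ℕ) (i : ι) : a i ≤ ∑ i, a i :=
  Finset.single_le_sum (fun _ _ => Nat.zero_le _) (Finset.mem_univ i)

lemma descFac_mono {μ σ : Fin n → ℕ} (h : μ ≤ σ) (α : Fin n → ℕ) : descFac μ α ≤ descFac σ α :=
  Finset.prod_le_prod (fun i _ => Nat.cast_nonneg _) fun i _ => by
    exact_mod_cast Nat.descFactorial_le _ (h i)

/-- Adding `β` raises each entry by at most `|β| = m`, and `descFac` has `|α| = m` linear factors in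
all; hence the constant `m * m`. -/
lemma descFac_sub_le {M : ℕ} (μ : Fin n → ℕ) (α β : MultiIndex n m)
    (hM : ∀ i, (β.1 + μ) i ≤ M) :
    M * (descFac (β.1 + μ) α.1 - descFac μ α.1) ≤ m * m * (M : ℝ) ^ m := by
  have := prod_sub_prod_le Finset.univ (fun i => ((μ i).descFactorial (α.1 i) : ℝ))
    (fun i => (((β.1 + μ) i).descFactorial (α.1 i) : ℝ)) α.1 (M := M) (t := m) (Nat.cast_nonneg _)
    (Nat.cast_nonneg _) (fun i _ => Nat.cast_nonneg _)
    (fun i _ => by exact_mod_cast Nat.descFactorial_le _ (Nat.le_add_left _ _))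
    (fun i _ => by
      exact_mod_cast (Nat.descFactorial_le_pow _ _).trans (Nat.pow_le_pow_left (hM i) _))
    (fun i _ => descFactorial_sub_le _ (Nat.le_add_left _ _)
      (by have := (le_sum_apply β.1 i).trans_eq β.2
          simp only [Pi.add_apply]; omega) (hM i))
  rwa [α.2] at this

/-- The product of the factorials of the entries of a multi-index, as a real number. -/
def fac (μ : Fin n → ℕ) : ℝ := ∏ i, ((μ i).factorial : ℝ)

lemma fac_pos (μ : Fin n → ℕ) : 0 < fac μ := univ_prod_factorial_pos μ

lemma fac_mul_descFac_add (α μ : Fin n → ℕ) : fac μ * descFac (α + μ) α = fac (α + μ) := by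
  rw [fac, descFac, fac, ← Finset.prod_mul_distrib]
  refine Finset.prod_congr rfl fun i _ => ?_
  have := Nat.factorial_mul_descFactorial (Nat.le_add_right (α i) (μ i))
  rw [Nat.add_sub_cancel_left] at this
  exact_mod_cast this

lemma descFac_eq_zero {μ α : Fin n → ℕ} (h : ¬ α ≤ μ) : descFac μ α = 0 := by
  obtain ⟨i, hi⟩ := not_forall.1 h
  refine Finset.prod_eq_zero (Finset.mem_univ i) ?_
  exact_mod_cast Nat.descFactorial_eq_zero_iff_lt.2 (not_le.1 hi)

/-- If `γ = μ - α = ν - β` is a multi-index, both sides are `μ! ν!/γ!`; otherwise both vanish. -/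
lemma fac_mul_descFac_comm {α β μ ν : Fin n → ℕ} (h : α + ν = β + μ) :
    fac μ * descFac ν β = fac ν * descFac μ α := by
  by_cases hα : α ≤ μ
  · obtain ⟨γ, rfl⟩ := exists_add_of_le hα
    have : ν = β + γ := add_left_cancel (h.trans (add_left_comm β α γ))
    subst this
    rw [← fac_mul_descFac_add α γ, ← fac_mul_descFac_add β γ]; ring
  · have hβ : ¬ β ≤ ν := by
      contrapose! hα
      intro i
      have h1 : β i ≤ ν i := hα i
      have h2 : α i + ν i = β i + μ i := congrFun h i
      change α i ≤ μ i
      omega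
    rw [descFac_eq_zero hα, descFac_eq_zero hβ, mul_zero, mul_zero]

/-- The difference of the two weights is `μ!` times one increment of falling factorials and also
`ν!` times another, each increment being at most `C`. Multiplying the two expressions bounds the
square by `C² μ! ν!`, the symmetric form needed for an `ℓ²` estimate. -/
lemma abs_fac_sub_le {k : ℕ} {α β : MultiIndex n m} {μ ν : MultiIndex n k}
    (h : α.1 + ν.1 = β.1 + μ.1) (hk : 0 < k + m) :
    |fac (α.1 + ν.1) - fac μ.1 * descFac ν.1 β.1| ≤
      (m * m * ((k + m : ℕ) : ℝ) ^ m / (k + m : ℕ)) * Real.sqrt (fac μ.1 * fac ν.1) := by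
  set C : ℝ := m * m * ((k + m : ℕ) : ℝ) ^ m / (k + m : ℕ) with hC
  have hk' : (0 : ℝ) < (k + m : ℕ) := by exact_mod_cast hk
  have hC0 : 0 ≤ C := by positivity
  have h1 : fac (α.1 + ν.1) - fac μ.1 * descFac ν.1 β.1 =
      fac μ.1 * (descFac (α.1 + ν.1) β.1 - descFac ν.1 β.1) := by
    rw [h, ← fac_mul_descFac_add β.1 μ.1]; ring
  have h2 : fac (α.1 + ν.1) - fac μ.1 * descFac ν.1 β.1 =
      fac ν.1 * (descFac (β.1 + μ.1) α.1 - descFac μ.1 α.1) := by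
    rw [← fac_mul_descFac_add α.1 ν.1, fac_mul_descFac_comm h, h]; ring
  have b1 : descFac (α.1 + ν.1) β.1 - descFac ν.1 β.1 ≤ C := by
    rw [hC, le_div_iff₀' hk']
    refine descFac_sub_le ν.1 β α fun i => ?_
    have := (le_sum_apply α.1 i).trans_eq α.2
    have := (le_sum_apply ν.1 i).trans_eq ν.2
    simp only [Pi.add_apply]; omega
  have b2 : descFac (β.1 + μ.1) α.1 - descFac μ.1 α.1 ≤ C := by
    rw [hC, le_div_iff₀' hk']
    refine descFac_sub_le μ.1 α β fun i => ?_
    have := (le_sum_apply β.1 i).trans_eq β.2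
    have := (le_sum_apply μ.1 i).trans_eq μ.2
    simp only [Pi.add_apply]; omega
  have p1 : 0 ≤ descFac (α.1 + ν.1) β.1 - descFac ν.1 β.1 :=
    sub_nonneg.2 (descFac_mono (fun i => Nat.le_add_left _ _) _)
  have p2 : 0 ≤ descFac (β.1 + μ.1) α.1 - descFac μ.1 α.1 :=
    sub_nonneg.2 (descFac_mono (fun i => Nat.le_add_left _ _) _)
  refine abs_le_of_sq_le_sq ?_ (by positivity)
  rw [mul_pow, Real.sq_sqrt (mul_pos (fac_pos _) (fac_pos _)).le]
  calc (fac (α.1 + ν.1) - fac μ.1 * descFac ν.1 β.1) ^ 2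
      = (fac μ.1 * fac ν.1) * ((descFac (α.1 + ν.1) β.1 - descFac ν.1 β.1) *
          (descFac (β.1 + μ.1) α.1 - descFac μ.1 α.1)) := by
        rw [sq]; nth_rw 1 [h1]; rw [h2]; ring
    _ ≤ (fac μ.1 * fac ν.1) * (C * C) :=
        mul_le_mul_of_nonneg_left (mul_le_mul b1 b2 p2 hC0)
          (mul_pos (fac_pos _) (fac_pos _)).le
    _ = _ := by ring

/-! ### Comparison of the two orderings and the stabilization theorem. -/

/-- The map `γ ↦ (α + γ, β + γ)` is a bijection onto the pairs with `α + ν = β + μ` and `β ≤ ν`.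
Pairs with `β ≰ ν` may be added freely because their falling factorial is zero. -/
lemma sum_multiIndex_add {d : ℕ} (α β : MultiIndex n m)
    (F : MultiIndex n (m + d) → MultiIndex n (m + d) → ℂ) :
    ∑ γ : MultiIndex n d, ((fac (α.add γ).1 * fac (β.add γ).1 / fac γ.1 : ℝ) : ℂ) *
      F (α.add γ) (β.add γ) =
    ∑ μ, ∑ ν, if α.1 + ν.1 = β.1 + μ.1 then ((fac μ.1 * descFac ν.1 β.1 : ℝ) : ℂ) * F μ ν
      else 0 := by
  rw [← Fintype.sum_prod_type' (f := fun μ ν : MultiIndex n (m + d) =>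
    if α.1 + ν.1 = β.1 + μ.1 then ((fac μ.1 * descFac ν.1 β.1 : ℝ) : ℂ) * F μ ν else 0)]
  refine Finset.sum_of_injOn (fun γ => (α.add γ, β.add γ)) ?_ (by simp [Set.MapsTo]) ?_ ?_
  · intro γ _ γ' _ h
    exact Subtype.ext (add_left_cancel (congrArg Subtype.val (congrArg Prod.fst h)))
  · rintro ⟨μ, ν⟩ - h
    split_ifs with h1
    · by_cases h2 : β.1 ≤ ν.1
      · exfalso
        obtain ⟨γ, hγ⟩ := exists_add_of_le h2
        refine h ⟨⟨γ, ?_⟩, by simp, ?_⟩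
        · have h3 : ∑ i, (ν.1 i : ℕ) = ∑ i, (β.1 i + γ i) := by rw [hγ]; rfl
          rw [Finset.sum_add_distrib, β.2, ν.2] at h3
          omega
        · have h4 : μ.1 = α.1 + γ := by
            rw [hγ, add_left_comm] at h1
            exact (add_left_cancel h1).symm
          exact Prod.ext (Subtype.ext h4.symm) (Subtype.ext hγ.symm)
      · simp [descFac_eq_zero h2]
    · rfl
  · intro γ _
    have h1 : α.1 + (β.add γ).1 = β.1 + (α.add γ).1 := add_left_comm _ _ _
    rw [if_pos h1]
    congr 2
    have := fac_mul_descFac_add β.1 γ.1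
    rw [show (β.add γ).1 = β.1 + γ.1 from rfl, ← this]
    field_simp [(fac_pos γ.1).ne']

/-- Scaling the vector by `μ!` turns the coefficient `d!/γ!` at `(α + γ, β + γ)` into `d! μ! ν!/γ!`,
so the result runs over the same indices as `antiForm`. -/
lemma dotProduct_stabMatrix (c : Matrix (MultiIndex n m) (MultiIndex n m) ℂ) (d : ℕ)
    (y : MultiIndex n (m + d) → ℂ) :
    star (fun μ => (fac μ.1 : ℂ) * y μ) ⬝ᵥ (stabMatrix c d).mulVec (fun μ => (fac μ.1 : ℂ) * y μ) =
    d.factorial * ∑ α, ∑ β, ∑ μ, ∑ ν, if α.1 + ν.1 = β.1 + μ.1 then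
      c α β * (star (y μ) * y ν) * (fac μ.1 * descFac ν.1 β.1 : ℝ) else 0 := by
  have h1 : star (fun μ => (fac μ.1 : ℂ) * y μ) ⬝ᵥ (stabMatrix c d).mulVec
      (fun μ => (fac μ.1 : ℂ) * y μ) = ∑ μ, ∑ ν, stabMatrix c d μ ν *
        star ((fac μ.1 : ℂ) * y μ) * ((fac ν.1 : ℂ) * y ν) := by
    simp only [dotProduct, Matrix.mulVec, Finset.mul_sum, Pi.star_apply]
    exact Finset.sum_congr rfl fun _ _ => Finset.sum_congr rfl fun _ _ => by ring
  rw [h1]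
  simp only [stabMatrix]
  rw [sum_sum_ite_mul (fun t : MultiIndex n m × MultiIndex n m × MultiIndex n d => t.1.add t.2.2)
    (fun t => t.2.1.add t.2.2) (fun t => c t.1 t.2.1 * (multinom t.2.2 : ℂ))
    (fun μ => star ((fac μ.1 : ℂ) * y μ)) (fun ν => (fac ν.1 : ℂ) * y ν)]
  simp only [Fintype.sum_prod_type, Finset.mul_sum (ι := MultiIndex n m)]
  refine Finset.sum_congr rfl fun α _ => Finset.sum_congr rfl fun β _ => ?_
  have h2 := sum_multiIndex_add (d := d) α β fun μ ν => c α β * (star (y μ) * y ν)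
  have h3 : ∀ μ ν : MultiIndex n (m + d), (if α.1 + ν.1 = β.1 + μ.1 then
      c α β * (star (y μ) * y ν) * (fac μ.1 * descFac ν.1 β.1 : ℝ) else 0) =
      if α.1 + ν.1 = β.1 + μ.1 then
        ((fac μ.1 * descFac ν.1 β.1 : ℝ) : ℂ) * (c α β * (star (y μ) * y ν)) else 0 := by
    intro μ ν; split_ifs <;> ring
  simp only [h3]
  rw [← h2, Finset.mul_sum]
  refine Finset.sum_congr rfl fun γ _ => ?_
  have : (multinom γ : ℂ) = d.factorial / (fac γ.1 : ℂ) := by simp [multinom, fac]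
  rw [this]
  simp only [star_mul', RCLike.star_def, Complex.conj_ofReal]
  push_cast
  ring

/-- A partial injection acts as a contraction on `ℓ²`: by `2ab ≤ a² + b²`, and each index occurs at
most once on either side. -/
lemma sum_ite_mul_le {ι : Type*} [Fintype ι] (r : ι → ι → Prop) [DecidableRel r] (x : ι → ℝ)
    (h1 : ∀ a b b', r a b → r a b' → b = b') (h2 : ∀ a a' b, r a b → r a' b → a = a') :
    ∑ a, ∑ b, (if r a b then x a * x b else 0) ≤ ∑ a, x a ^ 2 := by
  classical
  have e1 : ∑ a, ∑ b, (if r a b then x a ^ 2 else 0) ≤ ∑ a, x a ^ 2 := by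
    refine Finset.sum_le_sum fun a _ => ?_
    by_cases h : ∃ b, r a b
    · obtain ⟨b, hb⟩ := h
      rw [Finset.sum_eq_single b (fun b' _ hb' => if_neg fun h => hb' (h1 _ _ _ h hb)) (by simp),
        if_pos hb]
    · rw [Finset.sum_eq_zero fun b _ => if_neg fun hb => h ⟨b, hb⟩]
      positivity
  have e2 : ∑ a, ∑ b, (if r a b then x b ^ 2 else 0) ≤ ∑ a, x a ^ 2 := by
    rw [Finset.sum_comm]
    refine Finset.sum_le_sum fun b _ => ?_
    by_cases h : ∃ a, r a b
    · obtain ⟨a, ha⟩ := h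
      rw [Finset.sum_eq_single a (fun b' _ hb' => if_neg fun h => hb' (h2 _ _ _ h ha)) (by simp),
        if_pos ha]
    · rw [Finset.sum_eq_zero fun a _ => if_neg fun hb => h ⟨a, hb⟩]
      positivity
  have e3 : 2 * ∑ a, ∑ b, (if r a b then x a * x b else 0) ≤
      ∑ a, ∑ b, (if r a b then x a ^ 2 else 0) + ∑ a, ∑ b, (if r a b then x b ^ 2 else 0) := by
    rw [Finset.mul_sum, ← Finset.sum_add_distrib]
    refine Finset.sum_le_sum fun a _ => ?_
    rw [Finset.mul_sum, ← Finset.sum_add_distrib]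
    refine Finset.sum_le_sum fun b _ => ?_
    split_ifs
    · nlinarith [sq_nonneg (x a - x b)]
    · simp
  linarith

lemma norm_antiForm_sub_le {d : ℕ} (c : Matrix (MultiIndex n m) (MultiIndex n m) ℂ)
    (y : MultiIndex n (m + d) → ℂ) (hk : 0 < m + d + m) :
    ‖antiForm c y - ∑ α, ∑ β, ∑ μ, ∑ ν, (if α.1 + ν.1 = β.1 + μ.1 then
      c α β * (star (y μ) * y ν) * (fac μ.1 * descFac ν.1 β.1 : ℝ) else 0)‖ ≤
    (∑ α, ∑ β, ‖c α β‖) * (m * m * ((m + d + m : ℕ) : ℝ) ^ m / (m + d + m : ℕ)) *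
      ∑ μ, fac μ.1 * ‖y μ‖ ^ 2 := by
  set C : ℝ := m * m * ((m + d + m : ℕ) : ℝ) ^ m / (m + d + m : ℕ) with hC
  have hC0 : 0 ≤ C := by positivity
  simp only [antiForm, ← Finset.sum_sub_distrib, Finset.sum_mul]
  refine (norm_sum_le _ _).trans (Finset.sum_le_sum fun α _ => ?_)
  refine (norm_sum_le _ _).trans (Finset.sum_le_sum fun β _ => ?_)
  have h1 := sum_ite_mul_le (fun μ ν : MultiIndex n (m + d) => α.1 + ν.1 = β.1 + μ.1)
    (fun μ => Real.sqrt (fac μ.1) * ‖y μ‖)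
    (fun a b b' h h' => Subtype.ext (add_left_cancel (h.trans h'.symm)))
    (fun a a' b h h' => Subtype.ext (add_left_cancel (h.symm.trans h')))
  have h2 : ∀ μ : MultiIndex n (m + d), (Real.sqrt (fac μ.1) * ‖y μ‖) ^ 2 =
      fac μ.1 * ‖y μ‖ ^ 2 := fun μ => by rw [mul_pow, Real.sq_sqrt (fac_pos _).le]
  simp only [h2] at h1
  refine le_trans ?_ (mul_le_mul_of_nonneg_left h1 (mul_nonneg (norm_nonneg (c α β)) hC0))
  rw [Finset.mul_sum]
  refine (norm_sum_le _ _).trans (Finset.sum_le_sum fun μ _ => ?_)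
  rw [Finset.mul_sum]
  refine (norm_sum_le _ _).trans (Finset.sum_le_sum fun ν _ => ?_)
  split_ifs with h
  · rw [← mul_sub, ← Complex.ofReal_sub, norm_mul, Complex.norm_real, norm_mul, norm_mul, norm_star,
      Real.norm_eq_abs]
    have h3 := abs_fac_sub_le h hk
    rw [Real.sqrt_mul (fac_pos _).le] at h3
    have h4 := mul_le_mul_of_nonneg_left h3 (by positivity : 0 ≤ ‖c α β‖ * (‖y μ‖ * ‖y ν‖))
    refine h4.trans_eq ?_
    ring
  · simp

/-- With `k = m + d`, the bound `k + m ≤ 2k` gives `(k+m)^m ≤ 2^m k^m`, and the remaining division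
by `k + m > d₀` absorbs the constant. -/
lemma threshold_lt {d₀ d : ℕ} {B δ : ℝ} (hδ : 0 < δ) (hB0 : 0 ≤ B)
    (hd₀ : B * (m * m) * 2 ^ m / δ < d₀) (hd : d₀ + 1 ≤ d) :
    B * (m * m * ((m + d + m : ℕ) : ℝ) ^ m / (m + d + m : ℕ)) < δ * ((m + d : ℕ) : ℝ) ^ m := by
  have hd1 : (d₀ : ℝ) < d := by exact_mod_cast hd
  have hm0 : (0 : ℝ) ≤ m := Nat.cast_nonneg _
  have hd2 : (0 : ℝ) ≤ d₀ := Nat.cast_nonneg _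
  have hpos : (0 : ℝ) < (m + d + m : ℕ) := by exact_mod_cast (by omega : 0 < m + d + m)
  rw [mul_div_assoc', div_lt_iff₀ hpos]
  have a1 : ((m + d + m : ℕ) : ℝ) ^ m ≤ 2 ^ m * ((m + d : ℕ) : ℝ) ^ m := by
    rw [← mul_pow]
    refine pow_le_pow_left₀ (Nat.cast_nonneg _) ?_ m
    push_cast; linarith
  have a2 : B * (m * m) * 2 ^ m < δ * (m + d + m : ℕ) := by
    rw [div_lt_iff₀' hδ] at hd₀
    refine hd₀.trans (mul_lt_mul_of_pos_left ?_ hδ)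
    push_cast; linarith
  have a3 : (0 : ℝ) < ((m + d : ℕ) : ℝ) ^ m :=
    pow_pos (by exact_mod_cast (by omega : 0 < m + d)) m
  calc B * (m * m * ((m + d + m : ℕ) : ℝ) ^ m)
      ≤ B * (m * m * (2 ^ m * ((m + d : ℕ) : ℝ) ^ m)) := by gcongr
    _ = (B * (m * m) * 2 ^ m) * ((m + d : ℕ) : ℝ) ^ m := by ring
    _ < (δ * (m + d + m : ℕ)) * ((m + d : ℕ) : ℝ) ^ m := mul_lt_mul_of_pos_right a2 a3
    _ = _ := by ring
/-- The stabilization theorem: if `f ≥ δ ‖z‖^{2m}` with `δ > 0`, then the matrix of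
`‖z‖^{2d} f` is positive definite for all large `d`. -/
theorem eventually_posDef_stabMatrix {f : Cn n → ℝ}
    {c : Matrix (MultiIndex n m) (MultiIndex n m) ℂ} (hf : IsUnderlyingMatrix f c) {δ : ℝ}
    (hδ : 0 < δ) (h : ∀ z, δ * ‖z‖ ^ (2 * m) ≤ f z) :
    ∀ᶠ d in Filter.atTop, (stabMatrix c d).PosDef := by
  set B : ℝ := ∑ α, ∑ β, ‖c α β‖ with hB
  have hB0 : 0 ≤ B := Finset.sum_nonneg fun _ _ => Finset.sum_nonneg fun _ _ => norm_nonneg _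
  obtain ⟨d₀, hd₀⟩ := exists_nat_gt (B * (m * m) * 2 ^ m / δ)
  filter_upwards [Filter.eventually_ge_atTop (d₀ + 1)] with d hd
  refine Matrix.PosDef.of_dotProduct_mulVec_pos (isUnderlyingMatrix_stabMatrix hf d).isHermitian
    fun x hx => ?_
  set y : MultiIndex n (m + d) → ℂ := fun μ => x μ / (fac μ.1 : ℂ) with hy
  have hxy : x = fun μ => (fac μ.1 : ℂ) * y μ := by
    ext μ
    have : (fac μ.1 : ℂ) ≠ 0 := by exact_mod_cast (fac_pos μ.1).ne'
    simp only [hy]; field_simp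
  set S : ℝ := ∑ μ, fac μ.1 * ‖y μ‖ ^ 2 with hS
  have hS0 : 0 < S := by
    obtain ⟨μ, hμ⟩ := Function.ne_iff.1 hx
    refine Finset.sum_pos' (fun μ _ => mul_nonneg (fac_pos _).le (sq_nonneg _))
      ⟨μ, Finset.mem_univ _, ?_⟩
    have : y μ ≠ 0 := by
      intro h0
      rw [hxy] at hμ
      exact hμ (by simp [h0])
    exact mul_pos (fac_pos _) (by positivity)
  obtain ⟨T, hT⟩ : ∃ T : ℂ, T = ∑ α, ∑ β, ∑ μ, ∑ ν, (if α.1 + ν.1 = β.1 + μ.1 then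
      c α β * (star (y μ) * y ν) * (fac μ.1 * descFac ν.1 β.1 : ℝ) else 0) := ⟨_, rfl⟩
  have h1 := norm_antiForm_sub_le c y (by omega)
  rw [← hT] at h1
  have h2 : δ * (((m + d : ℕ) : ℝ) ^ m * S) ≤ (antiForm c y).re := le_antiForm hf hδ.le h y
  have h3 := (Complex.re_le_norm _).trans h1
  rw [Complex.sub_re] at h3
  have h4 := mul_lt_mul_of_pos_right (threshold_lt hδ hB0 hd₀ hd) hS0
  have h5 : 0 < T.re := by linarith [mul_assoc δ (((m + d : ℕ) : ℝ) ^ m) S]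
  have hE := dotProduct_stabMatrix c d y
  rw [← hT] at hE
  -- The comparison controls only the real part; the imaginary part vanishes because the matrix is
  -- Hermitian.
  have him := (isUnderlyingMatrix_stabMatrix hf d).isHermitian.im_star_dotProduct_mulVec_self x
  have hre : 0 < (star x ⬝ᵥ (stabMatrix c d).mulVec x).re := by
    rw [hxy, hE, ← Complex.ofReal_natCast, Complex.re_ofReal_mul]
    positivity
  exact Complex.pos_iff.2 ⟨hre, him.symm⟩

/-! ### Homogeneity and the minimum on the sphere. -/

lemma bihom_smul (c : Matrix (MultiIndex n m) (MultiIndex n m) ℂ) (t : ℝ) (z : Cn n) :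
    bihom c ((t : ℂ) • z) ((t : ℂ) • z) = ((t ^ (2 * m) : ℝ) : ℂ) * bihom c z z := by
  simp only [bihom, monom_smul, star_mul', star_pow, Finset.mul_sum, RCLike.star_def,
    Complex.conj_ofReal]
  refine Finset.sum_congr rfl fun _ _ => Finset.sum_congr rfl fun _ _ => ?_
  push_cast; ring

lemma IsUnderlyingMatrix.smul {f : Cn n → ℝ} {c : Matrix (MultiIndex n m) (MultiIndex n m) ℂ}
    (hf : IsUnderlyingMatrix f c) (t : ℝ) (z : Cn n) :
    f ((t : ℂ) • z) = t ^ (2 * m) * f z := by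
  have := hf ((t : ℂ) • z)
  rw [bihom_smul, ← hf z] at this
  exact_mod_cast this

lemma continuous_bihom (c : Matrix (MultiIndex n m) (MultiIndex n m) ℂ) :
    Continuous fun z => bihom c z z := by
  unfold bihom
  exact continuous_finsetSum _ fun α _ => continuous_finsetSum _ fun β _ =>
    (continuous_const.mul (continuous_monom α)).mul (continuous_monom β).star

lemma IsUnderlyingMatrix.continuous {f : Cn n → ℝ}
    {c : Matrix (MultiIndex n m) (MultiIndex n m) ℂ} (hf : IsUnderlyingMatrix f c) :
    Continuous f := by
  have : f = fun z => (bihom c z z).re := by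
    ext z; rw [← hf z]; rfl
  rw [this]
  exact Complex.continuous_re.comp (continuous_bihom c)

lemma exists_smul_sphere {E : Type*} [NormedAddCommGroup E] [NormedSpace ℂ E] {z₀ : E}
    (h₀ : ‖z₀‖ = 1) (z : E) : ∃ u : E, ‖u‖ = 1 ∧ z = (‖z‖ : ℂ) • u := by
  by_cases hz : z = 0
  · exact ⟨z₀, h₀, by simp [hz]⟩
  · have : (‖z‖ : ℂ) ≠ 0 := by exact_mod_cast norm_ne_zero_iff.2 hz
    refine ⟨(‖z‖ : ℂ)⁻¹ • z, ?_, by rw [smul_inv_smul₀ this]⟩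
    rw [norm_smul, norm_inv, Complex.norm_real, norm_norm, inv_mul_cancel₀ (norm_ne_zero_iff.2 hz)]

lemma IsUnderlyingMatrix.min_mul_le {f : Cn n → ℝ}
    {c : Matrix (MultiIndex n m) (MultiIndex n m) ℂ} (hf : IsUnderlyingMatrix f c) {z₀ : Cn n}
    (h₀ : z₀ ∈ Metric.sphere (0 : Cn n) 1) (hmin : IsMinOn f (Metric.sphere (0 : Cn n) 1) z₀)
    (z : Cn n) : f z₀ * ‖z‖ ^ (2 * m) ≤ f z := by
  obtain ⟨u, hu, hz⟩ := exists_smul_sphere (mem_sphere_zero_iff_norm.1 h₀) z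
  have : f z = ‖z‖ ^ (2 * m) * f u := by rw [← hf.smul, ← hz]
  rw [this, mul_comm]
  exact mul_le_mul_of_nonneg_left (isMinOn_iff.1 hmin u (mem_sphere_zero_iff_norm.2 hu))
    (by positivity)

lemma IsUnderlyingMatrix.exists_min {f : Cn n → ℝ}
    {c : Matrix (MultiIndex n m) (MultiIndex n m) ℂ} (hf : IsUnderlyingMatrix f c) (hn : 1 ≤ n)
    (h : ∀ z, z ≠ 0 → 0 < f z) : ∃ z₀ ∈ Metric.sphere (0 : Cn n) 1,
        IsMinOn f (Metric.sphere (0 : Cn n) 1) z₀ ∧ 0 < f z₀ := by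
  have hne : (Metric.sphere (0 : Cn n) 1).Nonempty :=
    ⟨EuclideanSpace.single ⟨0, hn⟩ 1, by simp⟩
  obtain ⟨z₀, h₀, hmin⟩ := (isCompact_sphere (0 : Cn n) 1).exists_isMinOn hne
    hf.continuous.continuousOn
  exact ⟨z₀, h₀, hmin, h z₀ (ne_zero_of_mem_unit_sphere ⟨z₀, h₀⟩)⟩

lemma pos_of_posDef {E : Matrix (MultiIndex n k) (MultiIndex n k) ℂ} (hE : E.PosDef) {F : Cn n → ℝ}
    (hF : IsUnderlyingMatrix F E) {z : Cn n} (hz : z ≠ 0) : 0 < F z := by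
  have h := hE.dotProduct_mulVec_pos (x := fun α => star (monom α z)) (by
    obtain ⟨α, hα⟩ := exists_monom_ne_zero (k := k) hz
    exact Function.ne_iff.2 ⟨α, star_ne_zero.2 hα⟩)
  rw [← bihom_eq_dotProduct, ← hF z] at h
  exact_mod_cast h

lemma pos_of_norm_pow_mul_pos {f : Cn n → ℝ} {d : ℕ} {z : Cn n} (h : 0 < ‖z‖ ^ (2 * d) * f z) :
    0 < f z := pos_of_mul_pos_right h (by positivity)

/-! ### The integral operator on the Bergman space. -/

lemma integrableOn_ball {g : Cn n → ℂ} (hg : Continuous g) :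
    IntegrableOn g (Metric.ball (0 : Cn n) 1) :=
  (hg.continuousOn.integrableOn_compact (isCompact_closedBall (0 : Cn n) 1)).mono_set
    Metric.ball_subset_closedBall

/-- The Gram matrix of the monomials of degree `k` in the Bergman space of the ball. -/
def gramMatrix (n k : ℕ) : Matrix (MultiIndex n k) (MultiIndex n k) ℂ := fun ν μ =>
  ∫ z in Metric.ball (0 : Cn n) 1, star (monom ν z) * monom μ z

lemma gramMatrix_mulVec (b : MultiIndex n k → ℂ) (ν : MultiIndex n k) :
    (gramMatrix n k).mulVec b ν =
      ∫ z in Metric.ball (0 : Cn n) 1, star (monom ν z) * hpoly b z := by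
  simp only [hpoly, Finset.mul_sum, Matrix.mulVec, dotProduct, gramMatrix]
  rw [integral_finsetSum]
  · refine Finset.sum_congr rfl fun μ _ => ?_
    rw [← integral_mul_const]
    congr 1
    ext z; ring
  · intro μ _
    exact integrableOn_ball ((continuous_monom ν).star.mul
      (continuous_const.mul (continuous_monom μ)))

/-- In monomial coordinates the operator is `E G` with `G` the Gram matrix, since the kernel is a
finite sum of products of a function of `z` and a function of `ζ`. -/
lemma kernelOp_bihom (E : Matrix (MultiIndex n k) (MultiIndex n k) ℂ) (b : MultiIndex n k → ℂ) :
    kernelOp (bihom E) (hpoly b) = hpoly (E.mulVec ((gramMatrix n k).mulVec b)) := by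
  ext z
  have h1 : ∀ ζ, bihom E z ζ * hpoly b ζ =
      ∑ μ, ∑ ν, (E μ ν * monom μ z) * (star (monom ν ζ) * hpoly b ζ) := by
    intro ζ
    simp only [bihom, Finset.sum_mul]
    exact Finset.sum_congr rfl fun _ _ => Finset.sum_congr rfl fun _ _ => by ring
  have hi : ∀ μ ν, IntegrableOn (fun ζ => (E μ ν * monom μ z) * (star (monom ν ζ) * hpoly b ζ))
      (Metric.ball (0 : Cn n) 1) := fun μ ν =>
    integrableOn_ball (continuous_const.mul ((continuous_monom ν).star.mul (continuous_hpoly b)))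
  simp only [kernelOp, h1]
  rw [integral_finsetSum _ fun μ _ => integrable_finsetSum _ fun ν _ => hi μ ν, hpoly]
  refine Finset.sum_congr rfl fun μ _ => ?_
  rw [integral_finsetSum _ fun ν _ => hi μ ν, Matrix.mulVec, dotProduct, Finset.sum_mul]
  refine Finset.sum_congr rfl fun ν _ => ?_
  rw [integral_const_mul, gramMatrix_mulVec]
  ring

lemma ballInner_hpoly (a b : MultiIndex n k → ℂ) :
    ballInner (hpoly a) (hpoly b) = star ((gramMatrix n k).mulVec b) ⬝ᵥ a := by
  have h1 : ∀ z, hpoly a z * star (hpoly b z) =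
      ∑ μ, a μ * star (star (monom μ z) * hpoly b z) := by
    intro z
    rw [hpoly, Finset.sum_mul]
    refine Finset.sum_congr rfl fun μ _ => ?_
    rw [star_mul', star_star]; ring
  simp only [ballInner, h1]
  rw [integral_finsetSum]
  · refine Finset.sum_congr rfl fun μ _ => ?_
    rw [integral_const_mul, Pi.star_apply, gramMatrix_mulVec, mul_comm]
    congr 1
    exact integral_conj
  · intro μ _
    exact integrableOn_ball (continuous_const.mul
      ((continuous_monom μ).star.mul (continuous_hpoly b)).star)

lemma ballInner_self_pos {b : MultiIndex n k → ℂ} (hb : b ≠ 0) :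
    0 < ballInner (hpoly b) (hpoly b) := by
  have h1 : ballInner (hpoly b) (hpoly b) =
      ((∫ z in Metric.ball (0 : Cn n) 1, ‖hpoly b z‖ ^ 2 : ℝ) : ℂ) := by
    rw [ballInner, ← integral_complex_ofReal]
    refine integral_congr_ae (Filter.Eventually.of_forall fun z => ?_)
    have := Complex.mul_conj' (hpoly b z)
    push_cast
    exact this
  have hc : Continuous fun z => ‖hpoly b z‖ ^ 2 := (continuous_hpoly b).norm.pow 2
  rw [h1]
  refine Complex.zero_lt_real.2 ?_
  rw [setIntegral_pos_iff_support_of_nonneg_ae]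
  · refine IsOpen.measure_pos _ ((hc.isOpen_support).inter Metric.isOpen_ball) ?_
    obtain ⟨z, hz⟩ : ∃ z, hpoly b z ≠ 0 := by
      by_contra! h
      exact hb (hpoly_eq_zero h)
    have hpos : 0 < 1 + ‖z‖ := by positivity
    -- By homogeneity a nonzero of the polynomial can be scaled into the open ball.
    refine ⟨(((1 + ‖z‖)⁻¹ : ℝ) : ℂ) • z, ?_, ?_⟩
    · rw [Function.mem_support, hpoly_smul]
      have : (((1 + ‖z‖)⁻¹ : ℝ) : ℂ) ≠ 0 := by exact_mod_cast (inv_pos.2 hpos).ne'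
      exact pow_ne_zero _ (norm_ne_zero_iff.2 (mul_ne_zero (pow_ne_zero _ this) hz))
    · rw [mem_ball_zero_iff, norm_smul, Complex.norm_real, Real.norm_eq_abs,
        abs_of_pos (inv_pos.2 hpos), inv_mul_lt_iff₀ hpos]
      linarith
  · exact Filter.Eventually.of_forall fun z => sq_nonneg _
  · exact (hc.continuousOn.integrableOn_compact (isCompact_closedBall (0 : Cn n) 1)).mono_set
      Metric.ball_subset_closedBall

lemma gramMatrix_mulVec_injective : Function.Injective (gramMatrix n k).mulVec := by
  intro a b h
  by_contra hab
  have := ballInner_self_pos (sub_ne_zero.2 hab)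
  rw [ballInner_hpoly, Matrix.mulVec_sub, h, sub_self] at this
  simp at this

lemma gramMatrix_mulVec_surjective : Function.Surjective (gramMatrix n k).mulVec :=
  (LinearMap.injective_iff_surjective (f := (gramMatrix n k).mulVecLin)).1
    gramMatrix_mulVec_injective

lemma ballInner_kernelOp (E : Matrix (MultiIndex n k) (MultiIndex n k) ℂ) (b : MultiIndex n k → ℂ) :
    ballInner (kernelOp (bihom E) (hpoly b)) (hpoly b) =
      star ((gramMatrix n k).mulVec b) ⬝ᵥ E.mulVec ((gramMatrix n k).mulVec b) := by
  rw [kernelOp_bihom, ballInner_hpoly]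

lemma posDef_of_isPositiveOn {E : Matrix (MultiIndex n k) (MultiIndex n k) ℂ}
    (hE : E.IsHermitian) (h : IsPositiveOn (kernelOp (bihom E)) k) : E.PosDef := by
  obtain ⟨-, ε, hε, h⟩ := h
  refine Matrix.PosDef.of_dotProduct_mulVec_pos hE fun x hx => ?_
  obtain ⟨b, rfl⟩ := gramMatrix_mulVec_surjective x
  have hb : b ≠ 0 := by
    rintro rfl
    exact hx (Matrix.mulVec_zero _)
  rw [← ballInner_kernelOp]
  exact (mul_pos (Complex.zero_lt_real.2 hε) (ballInner_self_pos hb)).trans_le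
    (h _ (hpoly_mem b))

/-- On the unit sphere `q₁` has a positive lower bound and `q₂` is bounded; quadratic homogeneity
extends the inequality. This turns strict positivity on a finite-dimensional space into the uniform
`ε` of (3). -/
lemma exists_pos_mul_le_of_homogeneous {E : Type*} [NormedAddCommGroup E] [NormedSpace ℂ E]
    [ProperSpace E] {q₁ q₂ : E → ℝ} (h₁ : Continuous q₁) (h₂ : Continuous q₂)
    (hq₁ : ∀ (t : ℝ) x, q₁ ((t : ℂ) • x) = t ^ 2 * q₁ x)
    (hq₂ : ∀ (t : ℝ) x, q₂ ((t : ℂ) • x) = t ^ 2 * q₂ x) (hpos : ∀ x, x ≠ 0 → 0 < q₁ x) :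
    ∃ ε : ℝ, 0 < ε ∧ ∀ x, ε * q₂ x ≤ q₁ x := by
  have hS := isCompact_sphere (0 : E) 1
  obtain ⟨a, ha, hqa⟩ := hS.exists_forall_le' h₁.continuousOn
    fun x hx => hpos x (ne_zero_of_mem_unit_sphere ⟨x, hx⟩)
  obtain ⟨M, hM⟩ := hS.exists_bound_of_continuousOn h₂.continuousOn
  have hM1 : 0 < |M| + 1 := by positivity
  refine ⟨a / (|M| + 1), div_pos ha hM1, fun x => ?_⟩
  by_cases hx : x = 0
  · have e1 := hq₁ 0 0
    have e2 := hq₂ 0 0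
    simp only [Complex.ofReal_zero, smul_zero, ne_eq, OfNat.ofNat_ne_zero, not_false_eq_true,
      zero_pow, zero_mul] at e1 e2
    rw [hx, e1, e2, mul_zero]
  · obtain ⟨u, hu, hxu⟩ : ∃ u : E, ‖u‖ = 1 ∧ x = (‖x‖ : ℂ) • u := by
      have h0 : (‖x‖ : ℂ) ≠ 0 := by exact_mod_cast norm_ne_zero_iff.2 hx
      refine exists_smul_sphere (z₀ := (‖x‖ : ℂ)⁻¹ • x) ?_ x
      rw [norm_smul, norm_inv, Complex.norm_real, norm_norm,
        inv_mul_cancel₀ (norm_ne_zero_iff.2 hx)]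
    rw [hxu, hq₁, hq₂, mul_left_comm]
    refine mul_le_mul_of_nonneg_left ?_ (sq_nonneg _)
    have hu' := mem_sphere_zero_iff_norm.2 hu
    rw [div_mul_eq_mul_div, div_le_iff₀ hM1]
    have b1 : q₂ u ≤ |M| + 1 :=
      (le_abs_self _).trans ((hM u hu').trans ((le_abs_self M).trans (by linarith)))
    exact (mul_le_mul_of_nonneg_left b1 ha.le).trans
      (mul_le_mul_of_nonneg_right (hqa u hu') hM1.le)

lemma dotProduct_mulVec_ofReal_smul {ι : Type*} [Fintype ι] (E : Matrix ι ι ℂ) (t : ℝ)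
    (x y : ι → ℂ) : (star ((t : ℂ) • x) ⬝ᵥ E.mulVec ((t : ℂ) • y)).re =
      t ^ 2 * (star x ⬝ᵥ E.mulVec y).re := by
  rw [Matrix.mulVec_smul, star_smul, smul_dotProduct, dotProduct_smul, RCLike.star_def,
    Complex.conj_ofReal, smul_smul, smul_eq_mul, ← Complex.ofReal_mul, Complex.re_ofReal_mul, sq]

lemma isPositiveOn_of_posDef {E : Matrix (MultiIndex n k) (MultiIndex n k) ℂ}
    (hE : E.PosDef) : IsPositiveOn (kernelOp (bihom E)) k := by
  refine ⟨fun g hg => ?_, ?_⟩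
  · obtain ⟨b, rfl⟩ := exists_hpoly hg
    rw [kernelOp_bihom]
    exact hpoly_mem _
  set G := gramMatrix n k with hG
  have hcont : Continuous G.mulVec := G.mulVecLin.continuous_of_finiteDimensional
  obtain ⟨ε, hε, h⟩ := exists_pos_mul_le_of_homogeneous
    (q₁ := fun b => (star (G.mulVec b) ⬝ᵥ E.mulVec (G.mulVec b)).re)
    (q₂ := fun b => (star (G.mulVec b) ⬝ᵥ (1 : Matrix _ _ ℂ).mulVec b).re)
    (Complex.continuous_re.comp (hcont.star.dotProduct
      (E.mulVecLin.continuous_of_finiteDimensional.comp hcont)))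
    (Complex.continuous_re.comp (hcont.star.dotProduct
      ((1 : Matrix _ _ ℂ).mulVecLin.continuous_of_finiteDimensional)))
    (fun t x => by rw [Matrix.mulVec_smul, dotProduct_mulVec_ofReal_smul])
    (fun t x => by rw [Matrix.mulVec_smul, dotProduct_mulVec_ofReal_smul])
    (fun x hx => by
      have hGx : G.mulVec x ≠ 0 := fun h0 => hx
        (gramMatrix_mulVec_injective (h0.trans (Matrix.mulVec_zero _).symm))
      exact (Complex.pos_iff.1 (hE.dotProduct_mulVec_pos hGx)).1)
  refine ⟨ε, hε, fun g hg => ?_⟩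
  obtain ⟨b, rfl⟩ := exists_hpoly hg
  rw [ballInner_kernelOp]
  have h1 : 0 ≤ ballInner (hpoly b) (hpoly b) := by
    by_cases hb : b = 0
    · rw [ballInner_hpoly, hb, dotProduct_zero]
    · exact (ballInner_self_pos hb).le
  have h2 := (Complex.nonneg_iff.1 h1).2
  have h3 := h b
  rw [Matrix.one_mulVec, hG, ← ballInner_hpoly] at h3
  refine Complex.le_def.2 ⟨by rwa [Complex.re_ofReal_mul], ?_⟩
  rw [Complex.im_ofReal_mul, ← h2, mul_zero]
  exact (hE.isHermitian.im_star_dotProduct_mulVec_self _).symm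

/-! ### Squared norms, decompositions and contractions. -/

variable {ι κ : Type} [Fintype ι] [Fintype κ]

/-- The linear map of Euclidean spaces with matrix `A`. -/
def eucl (A : Matrix ι κ ℂ) : EuclideanSpace ℂ κ →ₗ[ℂ] EuclideanSpace ℂ ι where
  toFun x := WithLp.toLp 2 (A.mulVec x)
  map_add' x y := by ext; simp [Matrix.mulVec_add]
  map_smul' t x := by ext; simp [Matrix.mulVec_smul]

/-- The vector of all monomials of degree `k`. -/
def monoms (k : ℕ) (z : Cn n) : EuclideanSpace ℂ (MultiIndex n k) :=
  WithLp.toLp 2 fun α => monom α z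

/-- The coefficient matrix of `‖A z^•‖²`. -/
def normSqMatrix (A : Matrix ι κ ℂ) : Matrix κ κ ℂ := A.transpose * A.transpose.conjTranspose

lemma norm_eucl_sq (A : Matrix ι κ ℂ) (x : EuclideanSpace ℂ κ) :
    ((‖eucl A x‖ ^ 2 : ℝ) : ℂ) =
      star (star (x : κ → ℂ)) ⬝ᵥ (normSqMatrix A).mulVec (star (x : κ → ℂ)) := by
  have h1 : ((‖eucl A x‖ ^ 2 : ℝ) : ℂ) = A.mulVec x ⬝ᵥ star (A.mulVec x) := by
    rw [EuclideanSpace.norm_sq_eq]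
    push_cast
    exact Finset.sum_congr rfl fun i _ => (Complex.mul_conj' _).symm
  rw [h1, normSqMatrix, ← Matrix.mulVec_mulVec, Matrix.dotProduct_mulVec, star_star,
    Matrix.vecMul_transpose]
  congr 1
  rw [Matrix.star_mulVec, ← Matrix.mulVec_transpose]
  rfl

lemma norm_eucl_monoms_sq (A : Matrix ι (MultiIndex n k) ℂ) (z : Cn n) :
    ((‖eucl A (monoms k z)‖ ^ 2 : ℝ) : ℂ) = bihom (normSqMatrix A) z z := by
  rw [norm_eucl_sq, bihom_eq_dotProduct]
  rfl

omit [Fintype ι] in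
lemma exists_eucl_monoms {g : Cn n → EuclideanSpace ℂ ι} (hg : ∀ i, (fun z => g z i) ∈ V n k) :
    ∃ A : Matrix ι (MultiIndex n k) ℂ, ∀ z, g z = eucl A (monoms k z) := by
  choose A hA using fun i => exists_hpoly (hg i)
  exact ⟨A, fun z => by ext i; exact congrFun (hA i) z⟩

lemma isHomogeneousMap_eucl_monoms {N : ℕ} (A : Matrix (Fin N) (MultiIndex n k) ℂ) :
    IsHomogeneousMap k fun z => eucl A (monoms k z) := fun j => hpoly_mem (A j)

lemma monoms_ne_zero {z : Cn n} (hz : z ≠ 0) : monoms k z ≠ 0 := by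
  obtain ⟨α, hα⟩ := exists_monom_ne_zero (k := k) hz
  exact fun h => hα (congrArg (fun v : EuclideanSpace ℂ (MultiIndex n k) => v α) h)

lemma monoms_zero (hk : k ≠ 0) : monoms k (0 : Cn n) = 0 := by
  ext α; exact monom_zero hk α

lemma exists_normSqMatrix_of_posDef {E : Matrix (MultiIndex n k) (MultiIndex n k) ℂ}
    (hE : E.PosDef) : ∃ (N : ℕ) (A : Matrix (Fin N) (MultiIndex n k) ℂ), normSqMatrix A = E := by
  obtain ⟨N, v, hv⟩ := Matrix.posSemidef_iff_eq_sum_vecMulVec.1 hE.posSemidef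
  refine ⟨N, v, ?_⟩
  ext μ ν
  rw [hv, Matrix.sum_apply]
  exact Matrix.mul_apply

/-- A Hermitian form is a difference of squared norms. -/
lemma exists_isDecomposition {f : Cn n → ℝ} {c : Matrix (MultiIndex n m) (MultiIndex n m) ℂ}
    (hf : IsUnderlyingMatrix f c) : ∃ (p q : ℕ) (P : Cn n → Cn p) (N : Cn n → Cn q),
      IsDecomposition f m P N := by
  classical
  have hc := hf.isHermitian
  let e := Fintype.equivFin (MultiIndex n m)
  have key : ∀ D : Matrix (MultiIndex n m) (MultiIndex n m) ℂ, D.IsHermitian →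
      normSqMatrix (D.submatrix id e.symm).transpose = D * D := by
    intro D hD
    rw [normSqMatrix, Matrix.transpose_transpose, Matrix.conjTranspose_submatrix, hD.eq,
      Matrix.submatrix_mul_equiv]
    rfl
  -- The identity `c = ((c+1)/2)² - ((c-1)/2)²` avoids diagonalization: squares of Hermitian
  -- matrices are coefficient matrices of squared norms.
  set D₁ : Matrix (MultiIndex n m) (MultiIndex n m) ℂ := (2⁻¹ : ℝ) • (c + 1) with hD₁
  set D₂ : Matrix (MultiIndex n m) (MultiIndex n m) ℂ := (2⁻¹ : ℝ) • (c - 1) with hD₂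
  have h₁ : D₁.IsHermitian := (hc.add Matrix.isHermitian_one).smul (IsSelfAdjoint.all _)
  have h₂ : D₂.IsHermitian := (hc.sub Matrix.isHermitian_one).smul (IsSelfAdjoint.all _)
  refine ⟨_, _, _, _, isHomogeneousMap_eucl_monoms (D₁.submatrix id e.symm).transpose,
    isHomogeneousMap_eucl_monoms (D₂.submatrix id e.symm).transpose, fun z => ?_⟩
  have h3 : D₁ * D₁ - D₂ * D₂ = c := by
    simp only [hD₁, hD₂, smul_mul_smul_comm, ← smul_sub]
    have : (c + 1) * (c + 1) - (c - 1) * (c - 1) = (4 : ℝ) • c := by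
      have h4 : (4 : ℝ) • c = c + c + c + c := by
        rw [show (4 : ℝ) = 1 + 1 + 1 + 1 by norm_num]; simp only [add_smul, one_smul]
      rw [h4]; noncomm_ring
    rw [this, smul_smul]; norm_num
  rw [← Complex.ofReal_inj, Complex.ofReal_sub, norm_eucl_monoms_sq, norm_eucl_monoms_sq,
    key _ h₁, key _ h₂, ← bihom_sub, h3, hf z]

/-- If `‖b x‖ ≤ ‖a x‖` with `a` injective, then `b` factors through `a` by a contraction. -/
lemma exists_contraction {X F G : Type*} [AddCommGroup X] [Module ℂ X]
    [NormedAddCommGroup F] [InnerProductSpace ℂ F] [FiniteDimensional ℂ F]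
    [NormedAddCommGroup G] [InnerProductSpace ℂ G]
    (a : X →ₗ[ℂ] F) (b : X →ₗ[ℂ] G) (ha : Function.Injective a) (hab : ∀ x, ‖b x‖ ≤ ‖a x‖) :
    ∃ L : F →L[ℂ] G, (∀ x, L (a x) = b x) ∧ ∀ v, ‖L v‖ ≤ ‖v‖ := by
  let e := LinearEquiv.ofInjective a ha
  let p : F →ₗ[ℂ] LinearMap.range a := (LinearMap.range a).orthogonalProjectionOnto.toLinearMap
  -- `L` is `b ∘ a⁻¹` on the range of `a` and zero on its orthogonal complement, so the projection
  -- keeps it contractive.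
  let L : F →ₗ[ℂ] G := b ∘ₗ e.symm.toLinearMap ∘ₗ p
  refine ⟨L.toContinuousLinearMap, fun x => ?_, fun v => ?_⟩
  · have : p (a x) = e x :=
      Submodule.orthogonalProjectionOnto_mem_subspace_eq_self (K := LinearMap.range a) (e x)
    simp [L, this]
  · have h1 : ‖a (e.symm (p v))‖ = ‖p v‖ := by
      have : e (e.symm (p v)) = p v := e.apply_symm_apply _
      rw [← this]; simp [e]
    exact (hab _).trans (h1.trans_le ((LinearMap.range a).norm_orthogonalProjectionOnto_apply_le v))

section Sqrt

variable {F G : Type*} [NormedAddCommGroup F] [InnerProductSpace ℂ F] [CompleteSpace F]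
  [NormedAddCommGroup G] [InnerProductSpace ℂ G] [CompleteSpace G]

open ContinuousLinearMap in
lemma re_inner_one_sub_adjoint_comp (L : F →L[ℂ] G) (v : F) :
    (inner ℂ ((1 - (adjoint L).comp L) v) v).re = ‖v‖ ^ 2 - ‖L v‖ ^ 2 := by
  rw [sub_apply, inner_sub_left, ContinuousLinearMap.comp_apply,
    ContinuousLinearMap.adjoint_inner_left, Complex.sub_re, one_apply_eq_self]
  have h1 := inner_self_eq_norm_sq (𝕜 := ℂ) v
  have h2 := inner_self_eq_norm_sq (𝕜 := ℂ) (L v)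
  exact congrArg₂ _ h1 h2

open ContinuousLinearMap in
lemma isPositive_one_sub_adjoint_comp {L : F →L[ℂ] G} (h : ∀ v, ‖L v‖ ≤ ‖v‖) :
    (1 - (adjoint L).comp L).IsPositive := by
  refine ContinuousLinearMap.isPositive_def'.2 ⟨?_, fun v => ?_⟩
  · exact (IsSelfAdjoint.one _).sub (isPositive_adjoint_comp_self L).isSelfAdjoint
  · rw [ContinuousLinearMap.reApplyInnerSelf_apply]
    refine (sub_nonneg.2 (pow_le_pow_left₀ (norm_nonneg _) (h v) 2)).trans_eq
      (re_inner_one_sub_adjoint_comp L v).symm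

open ContinuousLinearMap in
-- For `S = √(I - L*L)`, self-adjointness gives `‖Sv‖² = ⟨S²v, v⟩ = ⟨(I - L*L)v, v⟩`. Only this
-- identity is needed to handle the square root in (5).
lemma norm_sqrt_one_sub_sq {L : F →L[ℂ] G} (h : (1 - (adjoint L).comp L).IsPositive) (v : F) :
    ‖CFC.sqrt (1 - (adjoint L).comp L) v‖ ^ 2 = ‖v‖ ^ 2 - ‖L v‖ ^ 2 := by
  set T := 1 - (adjoint L).comp L with hT
  have h0 : 0 ≤ T := (nonneg_iff_isPositive T).2 h
  have h1 : CFC.sqrt T * CFC.sqrt T = T := CFC.sqrt_mul_sqrt_self T h0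
  have h2 : IsSelfAdjoint (CFC.sqrt T) := (CFC.sqrt_nonneg T).isSelfAdjoint
  rw [← re_inner_one_sub_adjoint_comp, ← hT, ← inner_self_eq_norm_sq (𝕜 := ℂ)]
  have h3 : T v = CFC.sqrt T (CFC.sqrt T v) := by
    rw [← mul_apply_eq_comp, h1]
  rw [h3]
  have h4 := adjoint_inner_left (CFC.sqrt T) v (CFC.sqrt T v)
  rw [h2.adjoint_eq] at h4
  rw [h4]
  rfl

end Sqrt

lemma norm_tensor (v : EuclideanSpace ℂ ι) (w : EuclideanSpace ℂ κ) :
    ‖tensor v w‖ ^ 2 = ‖v‖ ^ 2 * ‖w‖ ^ 2 := by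
  rw [EuclideanSpace.norm_sq_eq, EuclideanSpace.norm_sq_eq, EuclideanSpace.norm_sq_eq,
    Finset.sum_mul_sum, Fintype.sum_prod_type]
  simp [tensor, mul_pow]

lemma norm_H_sq (d : ℕ) (z : Cn n) : ‖H d z‖ ^ 2 = ‖z‖ ^ (2 * d) := by
  rw [← Complex.ofReal_inj, pow_mul, Complex.ofReal_pow (‖z‖ ^ 2), norm_sq_eq_sum_mul_star,
    sum_mul_star_pow, EuclideanSpace.norm_sq_eq, Complex.ofReal_sum]
  refine Finset.sum_congr rfl fun γ _ => ?_
  have h1 : monom γ z * star (monom γ z) = ((‖monom γ z‖ ^ 2 : ℝ) : ℂ) := by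
    rw [Complex.ofReal_pow]; exact Complex.mul_conj' _
  have h2 : H d z γ = ((Real.sqrt (multinom γ) : ℝ) : ℂ) * monom γ z := rfl
  rw [h1, h2, norm_mul, mul_pow, Complex.norm_real, Real.norm_eq_abs, sq_abs,
    Real.sq_sqrt (multinom_pos γ).le, Complex.ofReal_mul]

lemma mul_mem_V {l : ℕ} {g h : Cn n → ℂ} (hg : g ∈ V n k) (hh : h ∈ V n l) :
    (fun z => g z * h z) ∈ V n (k + l) := by
  obtain ⟨p, hp, hpg⟩ := hg
  obtain ⟨q, hq, hqh⟩ := hh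
  exact ⟨p * q, hp.mul hq, fun z => by rw [map_mul, ← hpg, ← hqh]⟩

lemma H_apply_mem (d : ℕ) (γ : MultiIndex n d) : (fun z : Cn n => H d z γ) ∈ V n d := by
  have h : (monom γ : Cn n → ℂ) = hpoly (Pi.single γ 1) := by
    ext z; simp [hpoly, Pi.single_apply]
  refine (V n d).smul_mem ((Real.sqrt (multinom γ) : ℝ) : ℂ) (x := monom γ) ?_
  rw [h]
  exact hpoly_mem _

lemma exists_tensor_H_eq {N : ℕ} {P : Cn n → Cn N} (hP : IsHomogeneousMap m P) (d : ℕ) :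
    ∃ A : Matrix (MultiIndex n d × Fin N) (MultiIndex n (m + d)) ℂ,
      ∀ z, tensor (H d z) (P z) = eucl A (monoms (m + d) z) :=
  exists_eucl_monoms fun i => by
    have := mul_mem_V (hP i.2) (H_apply_mem d i.1)
    convert this using 2 with z
    exact mul_comm _ _

lemma norm_tensor_H_sq {N : ℕ} (d : ℕ) (z : Cn n) (w : Cn N) :
    ‖tensor (H d z) w‖ ^ 2 = ‖z‖ ^ (2 * d) * ‖w‖ ^ 2 := by rw [norm_tensor, norm_H_sq]

/-- If the matrix of `‖z‖^{2d} f` is positive definite and `m + d > 0`, every decomposition of `f`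
satisfies the contraction condition. -/
lemma contractionCondition_of_posDef {f : Cn n → ℝ}
    {c : Matrix (MultiIndex n m) (MultiIndex n m) ℂ} (hf : IsUnderlyingMatrix f c) {d : ℕ}
    (hd : m + d ≠ 0) (hE : (stabMatrix c d).PosDef) {p q : ℕ} {P : Cn n → Cn p} {N : Cn n → Cn q}
    (h : IsDecomposition f m P N) : ContractionCondition P N := by
  obtain ⟨hP, hN, hfPN⟩ := h
  obtain ⟨A, hA⟩ := exists_tensor_H_eq hP d
  obtain ⟨B, hB⟩ := exists_tensor_H_eq hN d
  have hEAB : stabMatrix c d = normSqMatrix A - normSqMatrix B := by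
    refine (isUnderlyingMatrix_stabMatrix hf d).unique fun z => ?_
    beta_reduce
    rw [bihom_sub, ← norm_eucl_monoms_sq, ← norm_eucl_monoms_sq, ← hA, ← hB, norm_tensor_H_sq,
      norm_tensor_H_sq, hfPN]
    push_cast; ring
  -- Positive definiteness gives the strict inequality for every vector `x`, not only for vectors of
  -- monomials; this makes `A` injective and the factorization possible.
  have hpos : ∀ x, x ≠ 0 → ‖eucl B x‖ ^ 2 < ‖eucl A x‖ ^ 2 := by
    intro x hx
    have h1 := hE.dotProduct_mulVec_pos (x := star (x : _ → ℂ))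
      (fun h0 => hx (by ext i; exact star_eq_zero.1 (congrFun h0 i)))
    rw [hEAB, Matrix.sub_mulVec, dotProduct_sub, ← norm_eucl_sq, ← norm_eucl_sq,
      ← Complex.ofReal_sub] at h1
    exact sub_pos.1 (Complex.zero_lt_real.1 h1)
  have hinj : Function.Injective (eucl A) := by
    refine (injective_iff_map_eq_zero _).2 fun x hx => ?_
    by_contra h0
    have := hpos x h0
    rw [hx, norm_zero, zero_pow two_ne_zero] at this
    exact absurd this (sq_nonneg _).not_gt
  obtain ⟨L, hL, hLn⟩ := exists_contraction (eucl A) (eucl B) hinj fun x => by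
    by_cases hx : x = 0
    · simp [hx]
    · exact (pow_le_pow_iff_left₀ (norm_nonneg _) (norm_nonneg _) two_ne_zero).1 (hpos x hx).le
  have hT := isPositive_one_sub_adjoint_comp hLn
  refine ⟨d, L, hT, fun z => by rw [hA, hB, hL], ?_⟩
  ext z
  rw [Set.mem_ofPred_eq, Set.mem_singleton_iff]
  constructor
  · intro hz
    by_contra h0
    have h1 := norm_sqrt_one_sub_sq hT (tensor (H d z) (P z))
    rw [hz, hA, hL, norm_zero] at h1
    have := hpos _ (monoms_ne_zero (k := m + d) h0)
    linarith
  · rintro rfl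
    rw [hA, monoms_zero hd, map_zero, map_zero]

/-- Here `‖z‖^(2d) f(z) = ‖H_d ⊗ P‖² - ‖L(H_d ⊗ P)‖² = ‖√(I - L*L)(H_d ⊗ P)‖²`, which is nonzero off
the origin. -/
lemma pos_of_contractionCondition {f : Cn n → ℝ} {p q : ℕ} {P : Cn n → Cn p} {N : Cn n → Cn q}
    (h : IsDecomposition f m P N) (hPN : ContractionCondition P N) {z : Cn n} (hz : z ≠ 0) :
    0 < f z := by
  obtain ⟨d, L, hT, hL, h0⟩ := hPN
  refine pos_of_norm_pow_mul_pos (d := d) ?_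
  have h1 := norm_sqrt_one_sub_sq hT (tensor (H d z) (P z))
  rw [← hL, norm_tensor_H_sq, norm_tensor_H_sq, ← mul_sub, ← h.2.2] at h1
  rw [← h1]
  refine pow_pos (norm_pos_iff.2 fun h2 => hz ?_) 2
  have h3 : z ∈ ({0} : Set (Cn n)) := h0 ▸ h2
  exact h3

lemma exists_map_of_posDef {f : Cn n → ℝ} {c : Matrix (MultiIndex n m) (MultiIndex n m) ℂ}
    (hf : IsUnderlyingMatrix f c) {d : ℕ} (hd : m + d ≠ 0) (hE : (stabMatrix c d).PosDef) :
    ∃ (k : ℕ) (g : Cn n → Cn k), IsHomogeneousMap (m + d) g ∧ {z | g z = 0} = {0} ∧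
      ∀ z, ‖z‖ ^ (2 * d) * f z = ‖g z‖ ^ 2 := by
  obtain ⟨N, A, hA⟩ := exists_normSqMatrix_of_posDef hE
  have hg : ∀ z, ‖z‖ ^ (2 * d) * f z = ‖eucl A (monoms (m + d) z)‖ ^ 2 := fun z => by
    rw [← Complex.ofReal_inj, norm_eucl_monoms_sq, hA]
    exact isUnderlyingMatrix_stabMatrix hf d z
  refine ⟨N, fun z => eucl A (monoms (m + d) z), isHomogeneousMap_eucl_monoms A, ?_, hg⟩
  ext z
  rw [Set.mem_ofPred_eq, Set.mem_singleton_iff]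
  constructor
  · intro (hz : eucl A (monoms (m + d) z) = 0)
    by_contra h0
    have := pos_of_posDef hE (isUnderlyingMatrix_stabMatrix hf d) h0
    rw [hg, hz, norm_zero, zero_pow two_ne_zero] at this
    exact this.false
  · rintro rfl
    beta_reduce
    rw [monoms_zero hd, map_zero]

end HermitianStabilization

end

/-! ### The equivalences. -/

theorem theorem1 (n m : ℕ) (hn : 1 ≤ n)
    (f : HermitianStabilization.Cn n → ℝ)
    (c : Matrix (HermitianStabilization.MultiIndex n m)
      (HermitianStabilization.MultiIndex n m) ℂ)
    (hf : HermitianStabilization.IsUnderlyingMatrix f c) :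
    List.TFAE [
      -- (1)
      ∃ z₀ ∈ Metric.sphere (0 : HermitianStabilization.Cn n) 1,
        IsMinOn f (Metric.sphere (0 : HermitianStabilization.Cn n) 1) z₀ ∧ 0 < f z₀,
      -- (2)
      ∃ (d : ℕ) (E : Matrix (HermitianStabilization.MultiIndex n (m + d))
          (HermitianStabilization.MultiIndex n (m + d)) ℂ),
        HermitianStabilization.IsUnderlyingMatrix (fun z => ‖z‖ ^ (2 * d) * f z) E ∧ E.PosDef,
      -- (3)
      ∃ d : ℕ, HermitianStabilization.IsPositiveOn
        (HermitianStabilization.kernelOp (HermitianStabilization.stabKernel c d)) (m + d),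
      -- (4)
      ∃ (d k : ℕ) (g : HermitianStabilization.Cn n → HermitianStabilization.Cn k),
        HermitianStabilization.IsHomogeneousMap (m + d) g ∧ {z | g z = 0} = {0} ∧
        ∀ z, ‖z‖ ^ (2 * d) * f z = ‖g z‖ ^ 2,
      -- (5), for every decomposition
      ∀ (p q : ℕ) (P : HermitianStabilization.Cn n → HermitianStabilization.Cn p)
        (N : HermitianStabilization.Cn n → HermitianStabilization.Cn q),
        HermitianStabilization.IsDecomposition f m P N →
        HermitianStabilization.ContractionCondition P N,
      -- (5), for some decomposition
      ∃ (p q : ℕ) (P : HermitianStabilization.Cn n → HermitianStabilization.Cn p)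
        (N : HermitianStabilization.Cn n → HermitianStabilization.Cn q),
        HermitianStabilization.IsDecomposition f m P N ∧
        HermitianStabilization.ContractionCondition P N] := by
  open HermitianStabilization in
  have main : (∃ z₀ ∈ Metric.sphere (0 : Cn n) 1,
      IsMinOn f (Metric.sphere (0 : Cn n) 1) z₀ ∧ 0 < f z₀) →
      ∃ d : ℕ, m + d ≠ 0 ∧ (stabMatrix c d).PosDef := by
    rintro ⟨z₀, h₀, hmin, hpos⟩
    -- Taking `d ≥ 1` makes the degree `m + d` positive even when `m = 0`, so that the maps in (4)
    -- and (5) do vanish at the origin.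
    obtain ⟨d, hd, hE⟩ := ((Filter.eventually_ge_atTop 1).and
      (eventually_posDef_stabMatrix hf hpos (hf.min_mul_le h₀ hmin))).exists
    exact ⟨d, by omega, hE⟩
  tfae_have 1 → 2 := fun h => by
    obtain ⟨d, -, hE⟩ := main h
    exact ⟨d, _, HermitianStabilization.isUnderlyingMatrix_stabMatrix hf d, hE⟩
  tfae_have 2 → 1 := by
    rintro ⟨d, E, hE, hpos⟩
    exact hf.exists_min hn fun z hz => HermitianStabilization.pos_of_norm_pow_mul_pos
      (HermitianStabilization.pos_of_posDef hpos hE hz)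
  have hker : ∀ d, HermitianStabilization.stabKernel c d =
      HermitianStabilization.bihom (HermitianStabilization.stabMatrix c d) := fun d => by
    ext z ζ; exact HermitianStabilization.stabKernel_eq_bihom c d z ζ
  tfae_have 1 → 3 := fun h => by
    obtain ⟨d, -, hE⟩ := main h
    exact ⟨d, by rw [hker]; exact HermitianStabilization.isPositiveOn_of_posDef hE⟩
  tfae_have 3 → 2 := by
    rintro ⟨d, h⟩
    rw [hker] at h
    have hE := HermitianStabilization.isUnderlyingMatrix_stabMatrix hf d
    exact ⟨d, _, hE, HermitianStabilization.posDef_of_isPositiveOn hE.isHermitian h⟩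
  tfae_have 1 → 4 := fun h => by
    obtain ⟨d, hd, hE⟩ := main h
    exact ⟨d, HermitianStabilization.exists_map_of_posDef hf hd hE⟩
  tfae_have 4 → 1 := by
    rintro ⟨d, k, g, -, h0, hg⟩
    refine hf.exists_min hn fun z hz => HermitianStabilization.pos_of_norm_pow_mul_pos (d := d) ?_
    rw [hg]
    refine pow_pos (norm_pos_iff.2 fun h => hz ?_) 2
    have h1 : z ∈ ({0} : Set (HermitianStabilization.Cn n)) := h0 ▸ h
    exact h1
  tfae_have 1 → 5 := fun h p q P N hPN => by
    obtain ⟨d, hd, hE⟩ := main h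
    exact HermitianStabilization.contractionCondition_of_posDef hf hd hE hPN
  tfae_have 5 → 6 := fun h => by
    obtain ⟨p, q, P, N, hPN⟩ := HermitianStabilization.exists_isDecomposition hf
    exact ⟨p, q, P, N, hPN, h p q P N hPN⟩
  tfae_have 6 → 1 := by
    rintro ⟨p, q, P, N, hPN, h⟩
    exact hf.exists_min hn fun z hz => HermitianStabilization.pos_of_contractionCondition hPN h hz
  tfae_finish
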